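/- Let $0<|\alpha|<\pi/2$ and $p,s>0$, and let $a_1,a_2,\dots$ be independent random variables, each gamma distributed with density $\frac{1}{s^p\Gamma(p)}a^{p-1}e^{-a/s}$, $a\ge 0$. Let $S_\alpha=\{z\in\mathbb C:|\arg z|\le|\alpha|\}$ (with $0\in S_\alpha$), and for $z=re^{i\theta}$ with $r>0$, $|\theta|<|\alpha|$ put $$f_\alpha(z)=\frac{\sin(2|\alpha|)}{|2K_p(2e^{i\alpha}/s)|^2}\,\frac{1}{r^2\sin^2(\alpha+\theta)}\left[\frac{\sin(\alpha-\theta)}{\sin(\alpha+\theta)}\right]^{p-1}\exp\left\{-\frac{\sin(2\alpha)}{s}\left[\frac{1}{r\sin(\alpha-\theta)}+\frac{r}{\sin(\alpha+\theta)}\right]\right\},$$ and $f_\alpha(z)=0$ for all other $z\in\mathbb C$. Here $K_p(w)=\frac12\int_0^\infty t^{-p-1}e^{-\frac w2(t+1/t)}\,dt$ ($\operatorname{Re}w>0$) is the modified Bessel function of order $p$. Then: 1. The random continued fraction $$Z=\cfrac{1}{a_1e^{i\alpha}+\cfrac{1}{a_2e^{i\alpha}+\cfrac{1}{a_3e^{i\alpha}+\cdots}}}$$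 converges almost surely, takes values in $S_\alpha$ almost surely, and has probability density function $f_\alpha$ with respect to Lebesgue measure on $\mathbb C$. 2. Let $\mu$ be the distribution of the random matrix $\begin{pmatrix}0&1\\1&a_ne^{i\alpha}\end{pmatrix}$ on $\mathrm{GL}(2,\mathbb C)$. Then the measure $\nu(dz)=f_\alpha(z)\,dz$, regarded as a measure on the projective line $\mathbb C\cup\{\infty\}$, is $\mu$-invariant, i.e. $\int\nu(\{z: A\cdot z\in B\})\,\mu(dA)=\nu(B)$ for every Borel set $B$, where $\begin{pmatrix}a&b\\c&d\end{pmatrix}\cdot z=\frac{az+b}{cz+d}$. It is the only $\mu$-invariant probability measure on the projective line. 3. The support of $f_\alpha$ (the closure of $\{f_\alpha\neq0\}$) is $S_\alpha$; $f_\alpha$ is a $C^\infty$ function on $\mathbb C\cong\mathbb R^2$; and it decays exponentially fast at infinity in every direction contained in $S_\alpha$: for every $\theta$ with $|\theta|\le|\alpha|$ there is $c>0$ such that $f_\alpha(re^{i\theta})=O(e^{-cr})$ as $r\to\infty$. -/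

import Mathlib

open Real Set Filter Topology MeasureTheory ProbabilityTheory Matrix
open scoped ContDiff

namespace RandomCF

noncomputable section

/-- The modified Bessel function `K_p(z)` of real order `p`, for `Re z > 0`, given by
`K_p(z) = (1/2) ∫₀^∞ t^(-p-1) exp(-(z/2)(t + 1/t)) dt`. -/
def besselK (p : ℝ) (z : ℂ) : ℂ :=
  (1 / 2 : ℂ) * ∫ t in Ioi (0 : ℝ),
    ((t ^ (-p - 1) : ℝ) : ℂ) * Complex.exp (-(z / 2) * ((t + 1 / t : ℝ) : ℂ))

/-- The cone `S_α = {z : |arg z| ≤ |α|}` (it contains the vertex `0`, as `arg 0 = 0`). -/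
def cone (α : ℝ) : Set ℂ := {z | |Complex.arg z| ≤ |α|}

/-- The density `f_α` on the complex plane. The formula is used at the interior points
`z = r e^{iθ}`, `r > 0`, `|θ| < |α|`, of the cone `S_α`; the function is `0` outside the cone and
on its boundary (where the formula, which has vanishing denominators there, tends to `0`). -/
def density (α p s : ℝ) (z : ℂ) : ℝ :=
  open Classical in
  let r : ℝ := ‖z‖
  let θ : ℝ := Complex.arg z
  if z ≠ 0 ∧ |θ| < |α| then
    sin (2 * |α|) / ‖2 * besselK p (2 * Complex.exp (α * Complex.I) / s)‖ ^ 2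
      * (1 / (r ^ 2 * sin (α + θ) ^ 2))
      * (sin (α - θ) / sin (α + θ)) ^ (p - 1)
      * exp (-(sin (2 * α) / s) * (1 / (r * sin (α - θ)) + r / sin (α + θ)))
  else 0

/-- The measure `ν(dz) = f_α(z) dz` on the complex plane, `dz` being Lebesgue measure. -/
def nu (α p s : ℝ) : Measure ℂ :=
  (volume : Measure ℂ).withDensity fun z ↦ ENNReal.ofReal (density α p s z)

/-- The infinite continued fraction `1/(a₀ e^{iα} + 1/(a₁ e^{iα} + ...))`. Its `n`-th convergent
is the finite continued fraction that ends with `a_{n-1} e^{iα}`. -/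
def contFrac (α : ℝ) (a : ℕ → ℝ) : GenContFract ℂ :=
  ⟨0, Stream'.Seq.ofStream fun n ↦ ⟨1, (a n : ℂ) * Complex.exp (α * Complex.I)⟩⟩

/-- The matrix with rows `(0, 1)` and `(1, a e^{iα})`. -/
def matrixA (α a : ℝ) : GL (Fin 2) ℂ :=
  Matrix.GeneralLinearGroup.mkOfDetNeZero
    !![0, 1; 1, (a : ℂ) * Complex.exp (α * Complex.I)] (by simp)

/-- The Borel σ-algebra of the group of invertible complex `2 × 2` matrices. -/
instance : MeasurableSpace (GL (Fin 2) ℂ) := borel _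

instance : BorelSpace (GL (Fin 2) ℂ) := ⟨rfl⟩

/-- The Borel σ-algebra of the complex projective line `ℂ ∪ {∞}`. -/
instance : MeasurableSpace (OnePoint ℂ) := borel _

instance : BorelSpace (OnePoint ℂ) := ⟨rfl⟩

/-- The distribution `μ` on `GL(2, ℂ)` of the random matrix with rows `(0, 1)`, `(1, a e^{iα})`,
where `a` is gamma distributed with shape `p` and scale `s` (that is, rate `1/s`). -/
def mu (α p s : ℝ) : Measure (GL (Fin 2) ℂ) :=
  (gammaMeasure p (1 / s)).map (matrixA α)

/-- A measure `ρ` on the projective line `ℂ ∪ {∞}` is `m`-invariant if it is preserved by the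
projective action `z ↦ (az + b)/(cz + d)` of a random matrix with distribution `m`, chosen
independently of `z`: `∫ ρ {z | g • z ∈ B} m(dg) = ρ B` for every Borel set `B`. -/
def IsInvariantMeasure (m : Measure (GL (Fin 2) ℂ)) (ρ : Measure (OnePoint ℂ)) : Prop :=
  ∀ B : Set (OnePoint ℂ), MeasurableSet B → ∫⁻ g, ρ {z | g • z ∈ B} ∂m = ρ B

end

end RandomCF

/-!
Write `z = u e^{iα} + v e^{-iα}`. The cone `S_α` is the quadrant `u, v ≥ 0`, the inversion
`z ↦ 1 / z` is `(u, v) ↦ (v, u) / |z|²`, adding `a e^{iα}` adds `a` to `u`, and on the open quadrant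
`f_α` is a constant times `u^{-p-1} v^{p-1} exp (-(1/v + u + v²/u + 2 v cos 2α) / s)`
(`density_eq_kern`).

*Stationarity.* Averaging the translates `f_α (w - a e^{iα})` over the gamma law of `a` is a
one-dimensional integral in `u`, which becomes a gamma integral in `1 / (u - a) - 1 / u`. The
result is the density of `1 / Z` when `Z` has density `f_α`, so `f_α` is the density of a stationary
law of the chain `x ↦ 1 / (x + a e^{iα})` (`map_step_nu`).

*Normalization.* The square `|2 K_p(2 e^{iα} / s)|²` is the integral of the convolution of the
integrand of `2 K_p`, in exponential variables, with its conjugate. The integrand of the convolution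
is `exp (-(e^b m + e^{-b} m̄) / s)` up to a factor, with `Re m > 0`; moving the line of integration
makes it real, and the double integral so obtained is the mass of the unnormalized density
(`ofReal_besselNorm_eq`, `lintegral_density`).

*Convergence and uniqueness.* The finite continued fractions map the right half-plane to nested
discs of diameter `1 / R_n`, where `R_n = Re (q_n q̄_{n-1})` satisfies
`R_{n+1} = R_n + a_n cos α |q_n|²`. As `|q_n| |q_{n-1}| ≥ R_n`, two consecutive terms increase `R`
by at least a constant times the smaller one, and the law of large numbers gives `R_n → ∞`
(`tendsto_cfGap`, `ae_tendsto_sum_min`). So the limit `Z` does not depend on the tail started in the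
half-plane, and every stationary law carried by the cone is the law of `Z` (`map_eq_of_stationary`).

*The projective line.* An invariant probability measure does not charge `∞`, because it has only
countably many atoms while the pole `-a e^{iα}` has a diffuse law. On `ℂ` the cone is absorbing and
is reached in two steps with positive probability from every point, so a stationary law is carried
by the cone (`ae_mem_cone_of_stationary`), hence is the law of `Z`.

*Smoothness.* The functions `u^a v^b exp (…)`, extended by zero, are all bounded. This makes each of
them vanish to second order at the boundary of the quadrant, and their partial derivatives are linear
combinations of functions of the same form (`hasFDerivAt_kern`).
-/

namespace RandomCF

/-! ### Coordinates along the boundary rays of the cone -/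

/-- The coordinate `u` of `z = u e^{iα} + v e^{-iα}`. -/
noncomputable def cu (α : ℝ) (z : ℂ) : ℝ := (z.re * sin α + z.im * cos α) / sin (2 * α)

/-- The coordinate `v` of `z = u e^{iα} + v e^{-iα}`. -/
noncomputable def cv (α : ℝ) (z : ℂ) : ℝ := (z.re * sin α - z.im * cos α) / sin (2 * α)

/-- The unit vector `e^{iα}`. -/
noncomputable def ray (α : ℝ) : ℂ := Complex.exp (α * Complex.I)

lemma ray_re (α : ℝ) : (ray α).re = cos α := Complex.exp_ofReal_mul_I_re α

lemma ray_im (α : ℝ) : (ray α).im = sin α := Complex.exp_ofReal_mul_I_im α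

section Angle

variable {α : ℝ} (hα₀ : 0 < |α|) (hα₁ : |α| < π / 2)

include hα₀ hα₁

lemma sin_ne_zero_of_angle : sin α ≠ 0 := by
  have h := abs_lt.1 hα₁
  rcases lt_or_gt_of_ne (abs_pos.1 hα₀) with h0 | h0
  · exact (sin_neg_of_neg_of_neg_pi_lt h0 (by linarith)).ne
  · exact (sin_pos_of_pos_of_lt_pi h0 (by linarith)).ne'

omit hα₀ in
lemma cos_pos_of_angle : 0 < cos α := by
  have h := abs_lt.1 hα₁
  exact cos_pos_of_mem_Ioo ⟨by linarith, by linarith⟩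

lemma sin_two_mul_ne_zero : sin (2 * α) ≠ 0 := by
  rw [sin_two_mul]
  exact mul_ne_zero (mul_ne_zero two_ne_zero (sin_ne_zero_of_angle hα₀ hα₁))
    (cos_pos_of_angle hα₁).ne'

lemma abs_cos_two_mul_lt_one : |cos (2 * α)| < 1 := by
  rw [← sq_lt_one_iff_abs_lt_one]
  have h := sin_sq_add_cos_sq (2 * α)
  have : 0 < sin (2 * α) ^ 2 := by
    have := sin_two_mul_ne_zero hα₀ hα₁
    positivity
  linarith

lemma re_eq_coord (z : ℂ) : z.re = (cu α z + cv α z) * cos α := by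
  have h1 := sin_ne_zero_of_angle hα₀ hα₁
  have h2 := (cos_pos_of_angle hα₁).ne'
  rw [cu, cv, sin_two_mul]
  field_simp
  ring

lemma im_eq_coord (z : ℂ) : z.im = (cu α z - cv α z) * sin α := by
  have h1 := sin_ne_zero_of_angle hα₀ hα₁
  have h2 := (cos_pos_of_angle hα₁).ne'
  rw [cu, cv, sin_two_mul]
  field_simp
  ring

lemma normSq_eq_coord (z : ℂ) :
    Complex.normSq z = cu α z ^ 2 + cv α z ^ 2 + 2 * (cu α z * cv α z) * cos (2 * α) := by
  rw [Complex.normSq_apply]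
  have h := sin_sq_add_cos_sq α
  conv_lhs => rw [re_eq_coord hα₀ hα₁ z, im_eq_coord hα₀ hα₁ z]
  rw [cos_two_mul']
  linear_combination ((cu α z)^2 + (cv α z)^2) * h

lemma cu_add_ray (z : ℂ) (t : ℝ) : cu α (z + t * ray α) = cu α z + t := by
  have h1 := sin_ne_zero_of_angle hα₀ hα₁
  have h2 := (cos_pos_of_angle hα₁).ne'
  simp only [cu, Complex.add_re, Complex.add_im, Complex.re_ofReal_mul, Complex.im_ofReal_mul,
    ray_re, ray_im, sin_two_mul]
  field_simp
  ring

omit hα₀ hα₁ in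
lemma cv_add_ray (z : ℂ) (t : ℝ) : cv α (z + t * ray α) = cv α z := by
  simp only [cv, Complex.add_re, Complex.add_im, Complex.re_ofReal_mul, Complex.im_ofReal_mul,
    ray_re, ray_im]
  ring

omit hα₀ hα₁ in
lemma cu_inv (z : ℂ) : cu α z⁻¹ = cv α z / Complex.normSq z := by
  simp only [cu, cv, Complex.inv_re, Complex.inv_im]
  ring

omit hα₀ hα₁ in
lemma cv_inv (z : ℂ) : cv α z⁻¹ = cu α z / Complex.normSq z := by
  simp only [cu, cv, Complex.inv_re, Complex.inv_im]
  ring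

omit hα₀ hα₁ in
lemma cu_eq_norm_mul_sin (z : ℂ) : cu α z = ‖z‖ * sin (α + z.arg) / sin (2 * α) := by
  rw [cu, sin_add, mul_add]
  conv_lhs => rw [← Complex.norm_mul_cos_arg z, ← Complex.norm_mul_sin_arg z]
  ring

omit hα₀ hα₁ in
lemma cv_eq_norm_mul_sin (z : ℂ) : cv α z = ‖z‖ * sin (α - z.arg) / sin (2 * α) := by
  rw [cv, sin_sub, mul_sub]
  conv_lhs => rw [← Complex.norm_mul_cos_arg z, ← Complex.norm_mul_sin_arg z]
  ring

omit hα₀ hα₁ in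
lemma cu_neg_angle (z : ℂ) : cu (-α) z = cv α z := by
  simp only [cu, cv, mul_neg, sin_neg, cos_neg]
  rw [← neg_div_neg_eq]
  ring

omit hα₀ hα₁ in
lemma cv_neg_angle (z : ℂ) : cv (-α) z = cu α z := by
  simp only [cu, cv, mul_neg, sin_neg, cos_neg]
  rw [← neg_div_neg_eq]
  ring

omit hα₀ in
lemma coord_pos_aux (h : 0 < α) (z : ℂ) :
    (z ≠ 0 ∧ |z.arg| < α) ↔ 0 < cu α z ∧ 0 < cv α z := by
  have hα := abs_lt.1 hα₁
  have hs : 0 < sin (2 * α) := sin_pos_of_pos_of_lt_pi (by linarith) (by linarith)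
  have ha := Complex.arg_mem_Ioc z
  rw [cu_eq_norm_mul_sin, cv_eq_norm_mul_sin]
  constructor
  · rintro ⟨hz, ht⟩
    have ht := abs_lt.1 ht
    have := norm_pos_iff.2 hz
    have h1 : 0 < sin (α + z.arg) := sin_pos_of_pos_of_lt_pi (by linarith) (by linarith)
    have h2 : 0 < sin (α - z.arg) := sin_pos_of_pos_of_lt_pi (by linarith) (by linarith)
    exact ⟨by positivity, by positivity⟩
  · rintro ⟨hu, hv⟩
    rw [div_pos_iff_of_pos_right hs] at hu hv
    have hz : z ≠ 0 := by rintro rfl; simp at hu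
    have hn := norm_pos_iff.2 hz
    rw [mul_pos_iff_of_pos_left hn] at hu hv
    refine ⟨hz, abs_lt.2 ⟨?_, ?_⟩⟩
    · by_contra! hc
      have := sin_nonpos_of_nonpos_of_neg_pi_le (x := α + z.arg) (by linarith) (by linarith [ha.1])
      linarith
    · by_contra! hc
      have := sin_nonpos_of_nonpos_of_neg_pi_le (x := α - z.arg) (by linarith) (by linarith [ha.2])
      linarith

omit hα₀ in
lemma coord_nonneg_aux (h : 0 < α) (z : ℂ) :
    |z.arg| ≤ α ↔ 0 ≤ cu α z ∧ 0 ≤ cv α z := by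
  have hα := abs_lt.1 hα₁
  have hs : 0 < sin (2 * α) := sin_pos_of_pos_of_lt_pi (by linarith) (by linarith)
  have ha := Complex.arg_mem_Ioc z
  rcases eq_or_ne z 0 with rfl | hz
  · simp [cu, cv, h.le]
  have hn := norm_pos_iff.2 hz
  rw [cu_eq_norm_mul_sin, cv_eq_norm_mul_sin]
  constructor
  · intro ht
    have ht := abs_le.1 ht
    have h1 : 0 ≤ sin (α + z.arg) := sin_nonneg_of_nonneg_of_le_pi (by linarith) (by linarith)
    have h2 : 0 ≤ sin (α - z.arg) := sin_nonneg_of_nonneg_of_le_pi (by linarith) (by linarith)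
    exact ⟨by positivity, by positivity⟩
  · rintro ⟨hu, hv⟩
    rw [le_div_iff₀ hs, zero_mul, mul_nonneg_iff_of_pos_left hn] at hu hv
    refine abs_le.2 ⟨?_, ?_⟩
    · by_contra! hc
      have := sin_neg_of_neg_of_neg_pi_lt (x := α + z.arg) (by linarith) (by linarith [ha.1])
      linarith
    · by_contra! hc
      have := sin_neg_of_neg_of_neg_pi_lt (x := α - z.arg) (by linarith) (by linarith [ha.2])
      linarith

lemma coord_pos_iff (z : ℂ) : (z ≠ 0 ∧ |z.arg| < |α|) ↔ 0 < cu α z ∧ 0 < cv α z := by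
  rcases lt_or_gt_of_ne (abs_pos.1 hα₀) with h0 | h0
  · rw [abs_of_neg h0, coord_pos_aux (by rwa [abs_neg]) (by linarith), cu_neg_angle, cv_neg_angle,
      and_comm]
  · rw [abs_of_pos h0, coord_pos_aux hα₁ h0]

lemma mem_cone_iff (z : ℂ) : z ∈ cone α ↔ 0 ≤ cu α z ∧ 0 ≤ cv α z := by
  change |z.arg| ≤ |α| ↔ _
  rcases lt_or_gt_of_ne (abs_pos.1 hα₀) with h0 | h0
  · rw [abs_of_neg h0, coord_nonneg_aux (by rwa [abs_neg]) (by linarith), cu_neg_angle,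
      cv_neg_angle, and_comm]
  · rw [abs_of_pos h0, coord_nonneg_aux hα₁ h0]

lemma re_nonneg_of_mem_cone {z : ℂ} (hz : z ∈ cone α) : 0 ≤ z.re := by
  rw [mem_cone_iff hα₀ hα₁] at hz
  rw [re_eq_coord hα₀ hα₁]
  exact mul_nonneg (add_nonneg hz.1 hz.2) (cos_pos_of_angle hα₁).le

lemma coord_of_coord (u v : ℝ) :
    cu α (u * ray α + v * ray (-α)) = u ∧ cv α (u * ray α + v * ray (-α)) = v := by
  have h1 := sin_ne_zero_of_angle hα₀ hα₁
  have h2 := (cos_pos_of_angle hα₁).ne'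
  simp only [cu, cv, Complex.add_re, Complex.add_im, Complex.re_ofReal_mul, Complex.im_ofReal_mul,
    ray_re, ray_im, sin_two_mul, cos_neg, sin_neg]
  constructor <;> field_simp <;> ring

lemma eq_of_coord (z : ℂ) : z = cu α z * ray α + cv α z * ray (-α) := by
  apply Complex.ext
  · simp only [Complex.add_re, Complex.re_ofReal_mul, ray_re, cos_neg]
    rw [← add_mul]
    exact re_eq_coord hα₀ hα₁ z
  · simp only [Complex.add_im, Complex.im_ofReal_mul, ray_im, sin_neg]
    rw [mul_neg, ← sub_eq_add_neg, ← sub_mul]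
    exact im_eq_coord hα₀ hα₁ z

end Angle

lemma continuous_cu (α : ℝ) : Continuous (cu α) := by unfold cu; fun_prop

lemma continuous_cv (α : ℝ) : Continuous (cv α) := by unfold cv; fun_prop

/-! ### The density in these coordinates -/

/-- The function `u ^ a v ^ b exp (-c (1/v + u + v²/u + 2 v d))` on the open first quadrant,
extended by zero. Up to a constant, `f_α` is this function of the coordinates with `a = -p - 1`,
`b = p - 1`, `c = 1 / s`, `d = cos (2 α)`; the other exponents occur in its derivatives. -/
noncomputable def kern (c d a b : ℝ) (x : ℝ × ℝ) : ℝ :=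
  if 0 < x.1 ∧ 0 < x.2 then
    x.1 ^ a * x.2 ^ b * exp (-(c * (1 / x.2 + x.1 + x.2 ^ 2 / x.1 + 2 * x.2 * d)))
  else 0

lemma kern_of_pos {c d a b u v : ℝ} (hu : 0 < u) (hv : 0 < v) :
    kern c d a b (u, v) =
      u ^ a * v ^ b * exp (-(c * (1 / v + u + v ^ 2 / u + 2 * v * d))) := if_pos ⟨hu, hv⟩

lemma kern_nonneg (c d a b : ℝ) (x : ℝ × ℝ) : 0 ≤ kern c d a b x := by
  unfold kern
  split_ifs with h
  · have := h.1; have := h.2; positivity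
  · rfl

/-- The normalizing factor `|2 K_p(2 e^{iα} / s)|²`. -/
noncomputable def besselNorm (α p s : ℝ) : ℝ :=
  ‖2 * besselK p (2 * Complex.exp (α * Complex.I) / s)‖ ^ 2

lemma density_eq_kern {α p s : ℝ} (hα₀ : 0 < |α|) (hα₁ : |α| < π / 2) (z : ℂ) :
    density α p s z = (|sin (2 * α)| * besselNorm α p s)⁻¹ *
      kern (1 / s) (cos (2 * α)) (-p - 1) (p - 1) (cu α z, cv α z) := by
  unfold density kern
  simp only [coord_pos_iff hα₀ hα₁]
  split_ifs with h
  swap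
  · simp
  obtain ⟨hu, hv⟩ := h
  have hz : z ≠ 0 := ((coord_pos_iff hα₀ hα₁ z).2 ⟨hu, hv⟩).1
  have hn := norm_pos_iff.2 hz
  have hS := sin_two_mul_ne_zero hα₀ hα₁
  have e1 : sin (α + z.arg) = cu α z * sin (2 * α) / ‖z‖ := by
    rw [cu_eq_norm_mul_sin, div_mul_cancel₀ _ hS, mul_div_cancel_left₀ _ hn.ne']
  have e2 : sin (α - z.arg) = cv α z * sin (2 * α) / ‖z‖ := by
    rw [cv_eq_norm_mul_sin, div_mul_cancel₀ _ hS, mul_div_cancel_left₀ _ hn.ne']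
  have hr : ‖z‖ ^ 2 = cu α z ^ 2 + cv α z ^ 2 + 2 * (cu α z * cv α z) * cos (2 * α) := by
    rw [← Complex.normSq_eq_norm_sq, normSq_eq_coord hα₀ hα₁]
  have e3 : -(sin (2 * α) / s) * (1 / (‖z‖ * sin (α - z.arg)) + ‖z‖ / sin (α + z.arg)) =
      -(1 / s * (1 / cv α z + cu α z + cv α z ^ 2 / cu α z + 2 * cv α z * cos (2 * α))) := by
    have : ‖z‖ / sin (α + z.arg) = ‖z‖ ^ 2 / (cu α z * sin (2 * α)) := by rw [e1]; field_simp
    rw [this, hr, e2]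
    have := hu.ne'
    have := hv.ne'
    by_cases hs : s = 0
    · simp [hs]
    field_simp
    ring
  have e4 : sin (2 * |α|) = |sin (2 * α)| := by
    have h := abs_lt.1 hα₁
    rcases lt_or_gt_of_ne (abs_pos.1 hα₀) with h0 | h0
    · rw [abs_of_neg h0, mul_neg, sin_neg,
        abs_of_neg (sin_neg_of_neg_of_neg_pi_lt (by linarith) (by linarith))]
    · rw [abs_of_pos h0, abs_of_pos (sin_pos_of_pos_of_lt_pi (by linarith) (by linarith))]
  have e5 : (sin (α - z.arg) / sin (α + z.arg)) = cv α z / cu α z := by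
    rw [e1, e2]; have := hu.ne'; field_simp
  have e6 : 1 / (‖z‖ ^ 2 * sin (α + z.arg) ^ 2) = 1 / (cu α z ^ 2 * |sin (2 * α)| ^ 2) := by
    rw [e1, sq_abs]; field_simp
  have e7 : cu α z ^ (-p - 1) = (cu α z ^ 2)⁻¹ * (cu α z ^ (p - 1))⁻¹ := by
    rw [← rpow_natCast, ← rpow_neg hu.le, ← rpow_neg hu.le, ← rpow_add hu]
    congr 1; push_cast; ring
  rw [e3, e4, e5, e6, div_rpow hv.le hu.le, e7]
  change _ / besselNorm α p s * _ * _ * _ = _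
  have := abs_pos.2 hS
  have := hu.ne'
  rw [mul_inv]
  field_simp

/-! ### Smoothness, support and decay of the density -/

lemma exists_rpow_mul_exp_neg_le {a ε : ℝ} (ha : 0 ≤ a) (hε : 0 < ε) :
    ∃ M : ℝ, 0 ≤ M ∧ ∀ w : ℝ, 0 < w → w ^ a * exp (-(ε * w)) ≤ M := by
  have hk : 0 < a + 1 := by linarith
  refine ⟨((a + 1) / ε) ^ a, by positivity, fun w hw ↦ ?_⟩
  have h1 : ε * w / (a + 1) ≤ exp (ε * w / (a + 1)) := by
    linarith [add_one_le_exp (ε * w / (a + 1))]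
  have h2 : (ε * w / (a + 1)) ^ a ≤ exp (ε * w) :=
    calc (ε * w / (a + 1)) ^ a ≤ exp (ε * w / (a + 1)) ^ a :=
          rpow_le_rpow (by positivity) h1 ha
      _ = exp (ε * w / (a + 1) * a) := (exp_mul _ _).symm
      _ ≤ exp (ε * w) := by
          apply exp_le_exp.2
          rw [div_mul_eq_mul_div, div_le_iff₀ hk]
          have : 0 < ε * w := by positivity
          nlinarith
  have h3 : w = (a + 1) / ε * (ε * w / (a + 1)) := by field_simp
  rw [exp_neg, ← div_eq_mul_inv, div_le_iff₀ (exp_pos _)]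
  conv_lhs => rw [h3, mul_rpow (by positivity) (by positivity)]
  gcongr

lemma exists_rpow_mul_exp_neg_add_inv_le (b : ℝ) {ε : ℝ} (hε : 0 < ε) :
    ∃ M : ℝ, 0 ≤ M ∧ ∀ v : ℝ, 0 < v → v ^ b * exp (-(ε * (v + 1 / v))) ≤ M := by
  rcases le_total 0 b with hb | hb
  · obtain ⟨M, hM, h⟩ := exists_rpow_mul_exp_neg_le hb hε
    refine ⟨M, hM, fun v hv ↦ le_trans ?_ (h v hv)⟩
    have : 0 < 1 / v := by positivity
    gcongr
    linarith
  · obtain ⟨M, hM, h⟩ := exists_rpow_mul_exp_neg_le (neg_nonneg.2 hb) hε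
    refine ⟨M, hM, fun v hv ↦ le_trans ?_ (h (1 / v) (by positivity))⟩
    rw [one_div, inv_rpow hv.le, rpow_neg hv.le, inv_inv]
    have : 0 < v⁻¹ := by positivity
    gcongr
    linarith

section Kern

variable {c d : ℝ} (hc : 0 < c) (hd : |d| < 1)

lemma mul_add_le_of_abs {u v : ℝ} (hu : 0 < u) (hv : 0 < v) (d : ℝ) :
    (1 - |d|) * (u + v ^ 2 / u) ≤ u + v ^ 2 / u + 2 * v * d := by
  have h1 : 2 * v ≤ u + v ^ 2 / u := by
    have h : u + v ^ 2 / u - 2 * v = (u - v) ^ 2 / u := by field_simp; ring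
    have : 0 ≤ (u - v) ^ 2 / u := by positivity
    linarith
  have h2 : -|d| ≤ d := neg_abs_le d
  have h3 := abs_nonneg d
  nlinarith

include hc hd

/-- Negative powers of `u` are controlled through `u ^ a = (v ^ 2 / u) ^ (-a) * v ^ (2 * a)`. -/
lemma exists_kern_le (a b : ℝ) : ∃ M : ℝ, 0 ≤ M ∧ ∀ x, kern c d a b x ≤ M := by
  set δ := c * (1 - |d|) with hδdef
  have hδ : 0 < δ := mul_pos hc (by linarith)
  have key : ∀ u v : ℝ, 0 < u → 0 < v →
      exp (-(c * (1 / v + u + v ^ 2 / u + 2 * v * d))) ≤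
        exp (-(δ / 2 * u)) * exp (-(δ / 2 * (v ^ 2 / u))) * exp (-(δ / 2 * (v + 1 / v))) := by
    intro u v hu hv
    rw [← exp_add, ← exp_add]
    apply exp_le_exp.2
    have h1 := mul_le_mul_of_nonneg_left (mul_add_le_of_abs hu hv d) hc.le
    have h2 : 2 * v ≤ u + v ^ 2 / u := by
      have h : u + v ^ 2 / u - 2 * v = (u - v) ^ 2 / u := by field_simp; ring
      have : 0 ≤ (u - v) ^ 2 / u := by positivity
      linarith
    have h3 : δ / 2 * (2 * v) ≤ δ / 2 * (u + v ^ 2 / u) := by gcongr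
    have h4 : δ / 2 * (1 / v) ≤ c * (1 / v) := by
      have : δ / 2 ≤ c := by
        have := mul_nonneg hc.le (abs_nonneg d)
        rw [hδdef]; linarith
      gcongr
    have h5 : 0 < δ * v := by positivity
    rw [← mul_assoc, ← hδdef] at h1
    linarith
  rcases le_total 0 a with ha | ha
  · obtain ⟨M₁, hM₁, h₁⟩ := exists_rpow_mul_exp_neg_le ha (half_pos hδ)
    obtain ⟨M₂, hM₂, h₂⟩ := exists_rpow_mul_exp_neg_add_inv_le b (half_pos hδ)
    refine ⟨M₁ * M₂, by positivity, fun x ↦ ?_⟩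
    unfold kern
    split_ifs with h
    swap
    · positivity
    obtain ⟨hu, hv⟩ := h
    have h3 : exp (-(δ / 2 * (x.2 ^ 2 / x.1))) ≤ 1 := exp_le_one_iff.2 (by
      have : 0 < δ / 2 * (x.2 ^ 2 / x.1) := by positivity
      linarith)
    calc _ ≤ x.1 ^ a * x.2 ^ b * (exp (-(δ / 2 * x.1)) * exp (-(δ / 2 * (x.2 ^ 2 / x.1))) *
            exp (-(δ / 2 * (x.2 + 1 / x.2)))) := by gcongr; exact key _ _ hu hv
      _ ≤ x.1 ^ a * x.2 ^ b * (exp (-(δ / 2 * x.1)) * 1 *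
            exp (-(δ / 2 * (x.2 + 1 / x.2)))) := by gcongr
      _ = (x.1 ^ a * exp (-(δ / 2 * x.1))) *
            (x.2 ^ b * exp (-(δ / 2 * (x.2 + 1 / x.2)))) := by ring
      _ ≤ M₁ * M₂ := mul_le_mul (h₁ _ hu) (h₂ _ hv) (by positivity) hM₁
  · obtain ⟨M₁, hM₁, h₁⟩ := exists_rpow_mul_exp_neg_le (neg_nonneg.2 ha) (half_pos hδ)
    obtain ⟨M₂, hM₂, h₂⟩ := exists_rpow_mul_exp_neg_add_inv_le (b + 2 * a) (half_pos hδ)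
    refine ⟨M₁ * M₂, by positivity, fun x ↦ ?_⟩
    unfold kern
    split_ifs with h
    swap
    · positivity
    obtain ⟨hu, hv⟩ := h
    have h3 : exp (-(δ / 2 * x.1)) ≤ 1 := exp_le_one_iff.2 (by
      have : 0 < δ / 2 * x.1 := by positivity
      linarith)
    have h4 : x.1 ^ a * x.2 ^ b = (x.2 ^ 2 / x.1) ^ (-a) * x.2 ^ (b + 2 * a) := by
      rw [div_rpow (by positivity) hu.le, rpow_neg hu.le, div_inv_eq_mul, rpow_add hv,
        ← rpow_natCast x.2 2, ← rpow_mul hv.le]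
      have : x.2 ^ (((2 : ℕ) : ℝ) * -a) * x.2 ^ (2 * a) = 1 := by
        rw [← rpow_add hv]; push_cast; ring_nf; exact rpow_zero _
      linear_combination (-(x.1 ^ a * x.2 ^ b)) * this
    calc _ ≤ x.1 ^ a * x.2 ^ b * (exp (-(δ / 2 * x.1)) * exp (-(δ / 2 * (x.2 ^ 2 / x.1))) *
            exp (-(δ / 2 * (x.2 + 1 / x.2)))) := by gcongr; exact key _ _ hu hv
      _ ≤ x.1 ^ a * x.2 ^ b * (1 * exp (-(δ / 2 * (x.2 ^ 2 / x.1))) *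
            exp (-(δ / 2 * (x.2 + 1 / x.2)))) := by gcongr
      _ = ((x.2 ^ 2 / x.1) ^ (-a) * exp (-(δ / 2 * (x.2 ^ 2 / x.1)))) *
            (x.2 ^ (b + 2 * a) * exp (-(δ / 2 * (x.2 + 1 / x.2)))) := by rw [h4]; ring
      _ ≤ M₁ * M₂ := mul_le_mul (h₁ _ (by positivity)) (h₂ _ hv) (by positivity) hM₁

/-- At a point outside the open quadrant, `kern` vanishes to second order, because
`kern c d a b = u ^ 2 * kern c d (a - 2) b = v ^ 2 * kern c d a (b - 2)` with bounded factors. -/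
lemma hasFDerivAt_kern_zero (a b : ℝ) {x₀ : ℝ × ℝ} (hx₀ : ¬(0 < x₀.1 ∧ 0 < x₀.2)) :
    HasFDerivAt (kern c d a b) (0 : ℝ × ℝ →L[ℝ] ℝ) x₀ := by
  obtain ⟨M₁, hM₁, h₁⟩ := exists_kern_le hc hd (a - 2) b
  obtain ⟨M₂, hM₂, h₂⟩ := exists_kern_le hc hd a (b - 2)
  refine Asymptotics.IsBigO.hasFDerivAt (n := 2) ?_ one_lt_two
  refine Asymptotics.IsBigO.of_bound (M₁ + M₂) (Eventually.of_forall fun x ↦ ?_)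
  rw [Real.norm_of_nonneg (kern_nonneg ..), Real.norm_of_nonneg (by positivity)]
  by_cases h : 0 < x.1 ∧ 0 < x.2
  swap
  · rw [kern, if_neg h]; positivity
  have hn1 : |x.1 - x₀.1| ≤ ‖x - x₀‖ := norm_fst_le (x - x₀)
  have hn2 : |x.2 - x₀.2| ≤ ‖x - x₀‖ := norm_snd_le (x - x₀)
  obtain ⟨hu, hv⟩ := h
  by_cases h0 : 0 < x₀.1
  · have h0' : x₀.2 ≤ 0 := by by_contra! h'; exact hx₀ ⟨h0, h'⟩
    have hle : x.2 ≤ ‖x - x₀‖ := le_trans (by linarith) ((le_abs_self _).trans hn2)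
    have : kern c d a b x = x.2 ^ 2 * kern c d a (b - 2) x := by
      have hb : x.2 ^ b = x.2 ^ 2 * x.2 ^ (b - 2) := by
        rw [← rpow_natCast, ← rpow_add hv]; congr 1; push_cast; ring
      rw [kern, kern, if_pos ⟨hu, hv⟩, if_pos ⟨hu, hv⟩, hb]
      ring
    rw [this]
    calc _ ≤ ‖x - x₀‖ ^ 2 * M₂ := mul_le_mul (by gcongr) (h₂ x) (kern_nonneg ..) (by positivity)
      _ ≤ _ := by nlinarith [mul_nonneg hM₁ (sq_nonneg ‖x - x₀‖)]
  · have hle : x.1 ≤ ‖x - x₀‖ := le_trans (by linarith) ((le_abs_self _).trans hn1)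
    have : kern c d a b x = x.1 ^ 2 * kern c d (a - 2) b x := by
      have hb : x.1 ^ a = x.1 ^ 2 * x.1 ^ (a - 2) := by
        rw [← rpow_natCast, ← rpow_add hu]; congr 1; push_cast; ring
      rw [kern, kern, if_pos ⟨hu, hv⟩, if_pos ⟨hu, hv⟩, hb]
      ring
    rw [this]
    calc _ ≤ ‖x - x₀‖ ^ 2 * M₁ := mul_le_mul (by gcongr) (h₁ x) (kern_nonneg ..) (by positivity)
      _ ≤ _ := by nlinarith [mul_nonneg hM₂ (sq_nonneg ‖x - x₀‖)]

/-- The partial derivatives of `kern` are linear combinations of functions of the same form. -/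
lemma hasFDerivAt_kern (a b : ℝ) (x : ℝ × ℝ) :
    HasFDerivAt (kern c d a b)
      ((a * kern c d (a - 1) b x - c * kern c d a b x + c * kern c d (a - 2) (b + 2) x) •
          ContinuousLinearMap.fst ℝ ℝ ℝ +
        (b * kern c d a (b - 1) x + c * kern c d a (b - 2) x
          - 2 * c * kern c d (a - 1) (b + 1) x - 2 * c * d * kern c d a b x) •
          ContinuousLinearMap.snd ℝ ℝ ℝ) x := by
  by_cases h : 0 < x.1 ∧ 0 < x.2
  swap
  · have := hasFDerivAt_kern_zero hc hd a b h
    simpa [kern, if_neg h] using this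
  obtain ⟨hu, hv⟩ := h
  have hev : kern c d a b =ᶠ[𝓝 x] fun y ↦ y.1 ^ a * y.2 ^ b *
      exp (-(c * (y.2⁻¹ + y.1 + y.2 ^ 2 * y.1⁻¹ + 2 * y.2 * d))) := by
    have : ∀ᶠ y : ℝ × ℝ in 𝓝 x, 0 < y.1 ∧ 0 < y.2 :=
      (continuous_fst.continuousAt.eventually_const_lt hu).and
        (continuous_snd.continuousAt.eventually_const_lt hv)
    filter_upwards [this] with y hy
    rw [kern, if_pos hy, one_div, div_eq_mul_inv]
  refine HasFDerivAt.congr_of_eventuallyEq ?_ hev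
  have d1 : HasFDerivAt (fun y : ℝ × ℝ ↦ y.1) (ContinuousLinearMap.fst ℝ ℝ ℝ) x := hasFDerivAt_fst
  have d2 : HasFDerivAt (fun y : ℝ × ℝ ↦ y.2) (ContinuousLinearMap.snd ℝ ℝ ℝ) x := hasFDerivAt_snd
  have i1 : HasFDerivAt (fun y : ℝ × ℝ ↦ y.1⁻¹) _ x :=
    (hasDerivAt_inv hu.ne').comp_hasFDerivAt x d1
  have i2 : HasFDerivAt (fun y : ℝ × ℝ ↦ y.2⁻¹) _ x :=
    (hasDerivAt_inv hv.ne').comp_hasFDerivAt x d2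
  have p1 := d1.rpow_const (p := a) (Or.inl hu.ne')
  have p2 := d2.rpow_const (p := b) (Or.inl hv.ne')
  have e := ((((i2.add d1).add ((d2.pow 2).mul i1)).add ((d2.const_mul 2).mul_const d)).const_mul
    c).neg.exp
  have key := (p1.mul p2).mul e
  have r1 : ∀ t : ℝ, x.1 ^ (t - 1) = x.1 ^ t / x.1 := fun t ↦ rpow_sub_one hu.ne' t
  have r2 : ∀ t : ℝ, x.2 ^ (t - 1) = x.2 ^ t / x.2 := fun t ↦ rpow_sub_one hv.ne' t
  have r3 : ∀ t : ℝ, x.1 ^ (t - 2) = x.1 ^ t / x.1 ^ 2 := fun t ↦ by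
    rw [rpow_sub hu, ← rpow_natCast x.1 2]; norm_num
  have r4 : ∀ t : ℝ, x.2 ^ (t - 2) = x.2 ^ t / x.2 ^ 2 := fun t ↦ by
    rw [rpow_sub hv, ← rpow_natCast x.2 2]; norm_num
  have r5 : ∀ t : ℝ, x.2 ^ (t + 1) = x.2 ^ t * x.2 := fun t ↦ rpow_add_one hv.ne' t
  have r6 : ∀ t : ℝ, x.2 ^ (t + 2) = x.2 ^ t * x.2 ^ 2 := fun t ↦ by
    rw [rpow_add hv, ← rpow_natCast x.2 2]; norm_num
  refine key.congr_fderiv ?_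
  simp only [kern, if_pos (And.intro hu hv), r1, r2, r3, r4, r5, r6]
  have hu' := hu.ne'
  have hv' := hv.ne'
  ext
  · simp [div_eq_mul_inv]
    field_simp
    ring
  · simp [div_eq_mul_inv]
    field_simp
    ring

lemma contDiff_kern (a b : ℝ) : ContDiff ℝ ∞ (kern c d a b) := by
  rw [contDiff_infty]
  intro n
  induction n generalizing a b with
  | zero =>
    exact contDiff_zero.2 (continuous_iff_continuousAt.2 fun x ↦
      (hasFDerivAt_kern hc hd a b x).continuousAt)
  | succ n ih =>
    rw [Nat.cast_add, Nat.cast_one, contDiff_succ_iff_hasFDerivAt]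
    · exact ⟨_, ContDiff.add
        (ContDiff.smul (((contDiff_const.mul (ih _ _)).sub (contDiff_const.mul (ih _ _))).add
          (contDiff_const.mul (ih _ _))) contDiff_const)
        (ContDiff.smul ((((contDiff_const.mul (ih _ _)).add (contDiff_const.mul (ih _ _))).sub
          (contDiff_const.mul (ih _ _))).sub (contDiff_const.mul (ih _ _))) contDiff_const),
        hasFDerivAt_kern hc hd a b⟩

/-- Half of the exponent bounds the powers, the other half gives the decay. -/
lemma exists_kern_le_exp (a b : ℝ) :
    ∃ M k : ℝ, 0 < k ∧ ∀ x, kern c d a b x ≤ M * exp (-(k * x.1)) := by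
  obtain ⟨M, hM, h⟩ := exists_kern_le (half_pos hc) hd a b
  refine ⟨M, c / 2 * (1 - |d|), mul_pos (half_pos hc) (by linarith), fun x ↦ ?_⟩
  by_cases hx : 0 < x.1 ∧ 0 < x.2
  swap
  · rw [kern, if_neg hx]; positivity
  obtain ⟨hu, hv⟩ := hx
  set E := 1 / x.2 + x.1 + x.2 ^ 2 / x.1 + 2 * x.2 * d with hE
  have h1 : kern c d a b x = kern (c / 2) d a b x * exp (-(c / 2 * E)) := by
    rw [kern, kern, if_pos ⟨hu, hv⟩, if_pos ⟨hu, hv⟩, mul_assoc _ (exp _), ← exp_add]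
    congr 2
    ring
  have h2 : (1 - |d|) * x.1 ≤ E := by
    have h3 := mul_add_le_of_abs hu hv d
    have h4 : 0 ≤ (1 - |d|) * (x.2 ^ 2 / x.1) := mul_nonneg (by linarith) (by positivity)
    have h5 : 0 < 1 / x.2 := by positivity
    rw [hE]
    linarith
  rw [h1]
  refine mul_le_mul (h x) (exp_le_exp.2 (neg_le_neg ?_)) (exp_pos _).le hM
  rw [mul_assoc]
  gcongr

end Kern

section Density

variable {α p s : ℝ} (hα₀ : 0 < |α|) (hα₁ : |α| < π / 2) (hs : 0 < s)

include hα₀ hα₁ hs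

lemma contDiff_density : ContDiff ℝ ∞ (density α p s) := by
  have h : density α p s = fun z ↦ (|sin (2 * α)| * besselNorm α p s)⁻¹ *
      kern (1 / s) (cos (2 * α)) (-p - 1) (p - 1) (cu α z, cv α z) :=
    funext fun z ↦ density_eq_kern hα₀ hα₁ z
  rw [h]
  have hre : ContDiff ℝ ∞ fun z : ℂ ↦ z.re := Complex.reCLM.contDiff
  have him : ContDiff ℝ ∞ fun z : ℂ ↦ z.im := Complex.imCLM.contDiff
  refine contDiff_const.mul ((contDiff_kern (one_div_pos.2 hs)
    (abs_cos_two_mul_lt_one hα₀ hα₁) _ _).comp (ContDiff.prodMk ?_ ?_))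
  · exact ((hre.mul contDiff_const).add (him.mul contDiff_const)).div_const _
  · exact ((hre.mul contDiff_const).sub (him.mul contDiff_const)).div_const _

lemma density_isBigO_exp (θ : ℝ) : ∃ c : ℝ, 0 < c ∧
    (fun r : ℝ ↦ density α p s (r * Complex.exp (θ * Complex.I)))
      =O[atTop] fun r : ℝ ↦ Real.exp (-c * r) := by
  obtain ⟨M, k, hk, h⟩ := exists_kern_le_exp (one_div_pos.2 hs)
    (abs_cos_two_mul_lt_one hα₀ hα₁) (-p - 1) (p - 1)
  have hcu : ∀ r : ℝ, cu α (r * ray θ) = r * cu α (ray θ) := fun r ↦ by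
    simp only [cu, Complex.re_ofReal_mul, Complex.im_ofReal_mul]; ring
  by_cases hu : 0 < cu α (ray θ)
  · refine ⟨k * cu α (ray θ), by positivity, Asymptotics.IsBigO.of_bound
      (|(|sin (2 * α)| * besselNorm α p s)⁻¹| * M) (Eventually.of_forall fun r ↦ ?_)⟩
    change ‖density α p s (r * ray θ)‖ ≤ _
    rw [density_eq_kern hα₀ hα₁, norm_mul, Real.norm_of_nonneg (kern_nonneg ..),
      Real.norm_of_nonneg (exp_pos _).le, Real.norm_eq_abs, mul_assoc]
    refine mul_le_mul_of_nonneg_left ((h _).trans_eq ?_) (abs_nonneg _)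
    rw [hcu]
    congr 2
    ring
  · refine ⟨1, one_pos, Asymptotics.IsBigO.of_bound 1 ?_⟩
    filter_upwards [eventually_gt_atTop 0] with r hr
    have : ¬(0 < cu α (r * ray θ) ∧ 0 < cv α (r * ray θ)) := by
      rw [hcu, mul_pos_iff_of_pos_left hr]; exact fun h ↦ hu h.1
    change ‖density α p s (r * ray θ)‖ ≤ _
    rw [density_eq_kern hα₀ hα₁, kern, if_neg this, mul_zero, norm_zero]
    positivity

omit hs in
lemma tsupport_density (hN : 0 < besselNorm α p s) : tsupport (density α p s) = cone α := by
  have hsupp : Function.support (density α p s) = {z | 0 < cu α z ∧ 0 < cv α z} := by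
    ext z
    rw [Function.mem_support, density_eq_kern hα₀ hα₁, kern, Set.mem_ofPred_eq]
    have := abs_pos.2 (sin_two_mul_ne_zero hα₀ hα₁)
    split_ifs with h
    · refine iff_of_true (ne_of_gt ?_) h
      have := h.1
      have := h.2
      positivity
    · simp [h]
  rw [tsupport, hsupp]
  refine Subset.antisymm (closure_minimal (fun z hz ↦ ?_) ?_) fun z hz ↦ ?_
  · exact (mem_cone_iff hα₀ hα₁ z).2 ⟨hz.1.le, hz.2.le⟩
  · have : cone α = {z | 0 ≤ cu α z} ∩ {z | 0 ≤ cv α z} :=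
      Set.ext fun z ↦ mem_cone_iff hα₀ hα₁ z
    rw [this]
    exact (isClosed_le continuous_const (continuous_cu α)).inter
      (isClosed_le continuous_const (continuous_cv α))
  · rw [mem_cone_iff hα₀ hα₁] at hz
    have hc : Continuous fun ε : ℝ ↦
        ((cu α z + ε : ℝ) : ℂ) * ray α + ((cv α z + ε : ℝ) : ℂ) * ray (-α) := by fun_prop
    have ht : Tendsto (fun ε : ℝ ↦
        ((cu α z + ε : ℝ) : ℂ) * ray α + ((cv α z + ε : ℝ) : ℂ) * ray (-α)) (𝓝[>] 0) (𝓝 z) := by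
      have h := (hc.tendsto 0).mono_left (nhdsWithin_le_nhds (s := Ioi 0))
      rwa [add_zero, add_zero, ← eq_of_coord hα₀ hα₁] at h
    refine mem_closure_of_tendsto ht ?_
    filter_upwards [self_mem_nhdsWithin] with ε hε
    have hε : 0 < ε := hε
    have h := coord_of_coord hα₀ hα₁ (cu α z + ε) (cv α z + ε)
    change 0 < cu α _ ∧ 0 < cv α _
    rw [h.1, h.2]
    exact ⟨by linarith, by linarith⟩

end Density

/-! ### Exponential change of variables -/

lemma image_exp_univ : Real.exp '' univ = Ioi 0 := by
  rw [image_univ, Real.range_exp]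

lemma lintegral_Ioi_eq_lintegral_exp (g : ℝ → ENNReal) :
    ∫⁻ t in Ioi (0 : ℝ), g t = ∫⁻ a : ℝ, ENNReal.ofReal (exp a) * g (exp a) := by
  rw [← image_exp_univ, lintegral_image_eq_lintegral_abs_deriv_mul MeasurableSet.univ
    (fun x _ ↦ (Real.hasDerivAt_exp x).hasDerivWithinAt) Real.exp_injective.injOn]
  simp

lemma integral_Ioi_eq_integral_exp (g : ℝ → ℂ) :
    ∫ t in Ioi (0 : ℝ), g t = ∫ a : ℝ, (exp a : ℂ) * g (exp a) := by
  rw [← image_exp_univ, integral_image_eq_integral_abs_deriv_smul MeasurableSet.univ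
    (fun x _ ↦ (Real.hasDerivAt_exp x).hasDerivWithinAt) Real.exp_injective.injOn]
  simp

/-! ### The product formula for the Bessel function -/

lemma integrable_exp_mul_sub_cosh (k : ℝ) {ε : ℝ} (hε : 0 < ε) :
    Integrable fun a : ℝ ↦ exp (k * a - ε * (exp a + exp (-a))) := by
  have h := (integrable_cexp_quadratic' (b := ((-(ε / 2) : ℝ) : ℂ))
    (by rw [Complex.ofReal_re]; linarith) k 0).norm
  refine h.mono' (by fun_prop) (Eventually.of_forall fun a ↦ ?_)
  rw [Real.norm_of_nonneg (exp_pos _).le, Complex.norm_exp]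
  apply exp_le_exp.2
  have h1 : a ^ 2 / 2 ≤ exp a + exp (-a) := by
    rcases le_total 0 a with ha | ha
    · have := Real.quadratic_le_exp_of_nonneg ha
      linarith [exp_pos (-a)]
    · have := Real.quadratic_le_exp_of_nonneg (neg_nonneg.2 ha)
      rw [neg_sq] at this
      linarith [exp_pos a]
  have h2 : (((-(ε / 2) : ℝ) : ℂ) * (a : ℂ) ^ 2 + k * a + 0).re = -(ε / 2) * a ^ 2 + k * a := by
    rw [← Complex.ofReal_pow, ← Complex.ofReal_mul, ← Complex.ofReal_mul, ← Complex.ofReal_add,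
      add_zero, Complex.ofReal_re]
  rw [h2]
  nlinarith

section Rotation

/-- The entire function `exp (-l (e^ζ + e^{-ζ}))`, restricted to the line of height `t`. -/
noncomputable def expCosh (l : ℝ) (t a : ℝ) : ℂ :=
  Complex.exp (-(l * (Complex.exp (a + t * Complex.I) + Complex.exp (-(a + t * Complex.I)))))

lemma norm_expCosh (l t a : ℝ) : ‖expCosh l t a‖ = exp (-(l * cos t * (exp a + exp (-a)))) := by
  rw [expCosh, Complex.norm_exp]
  congr 1
  simp only [Complex.neg_re, Complex.add_re, Complex.exp_re,
    Complex.ofReal_re, Complex.mul_re, Complex.I_re, Complex.ofReal_im, Complex.I_im,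
    Complex.add_im, Complex.mul_im, Complex.neg_im, mul_zero, mul_one, sub_zero, zero_add, add_zero,
    cos_neg]
  ring

/-- The derivative of `expCosh` along the line; `i` times it is the derivative in the height. -/
noncomputable def expCosh' (l : ℝ) (t a : ℝ) : ℂ :=
  expCosh l t a *
    -(l * (Complex.exp (a + t * Complex.I) - Complex.exp (-(a + t * Complex.I))))

lemma norm_expCosh'_le {l : ℝ} (hl : 0 < l) (t a : ℝ) :
    ‖expCosh' l t a‖ ≤
      l * ((exp a + exp (-a)) * exp (-(l * cos t * (exp a + exp (-a))))) := by
  rw [expCosh', norm_mul, norm_expCosh, norm_neg, norm_mul, Complex.norm_of_nonneg hl.le]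
  have h := norm_sub_le (Complex.exp (a + t * Complex.I)) (Complex.exp (-(a + t * Complex.I)))
  rw [Complex.norm_exp, Complex.norm_exp] at h
  simp only [Complex.add_re, Complex.ofReal_re, Complex.mul_re, Complex.I_re, Complex.ofReal_im,
    Complex.I_im, Complex.neg_re, mul_zero, mul_one, sub_zero, add_zero] at h
  calc _ ≤ exp (-(l * cos t * (exp a + exp (-a)))) * (l * (exp a + exp (-a))) := by gcongr
    _ = _ := by ring

lemma hasDerivAt_expCosh_complex (l : ℝ) (w : ℂ) :
    HasDerivAt (fun w : ℂ ↦ Complex.exp (-(l * (Complex.exp w + Complex.exp (-w)))))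
      (Complex.exp (-(l * (Complex.exp w + Complex.exp (-w)))) *
        -(l * (Complex.exp w - Complex.exp (-w)))) w := by
  have h1 := Complex.hasDerivAt_exp w
  have h2 : HasDerivAt (fun w : ℂ ↦ Complex.exp (-w)) (Complex.exp (-w) * -1) w :=
    (hasDerivAt_neg w).cexp
  refine ((h1.add h2).const_mul (l : ℂ)).neg.cexp.congr_deriv ?_
  simp only [Pi.neg_apply, Pi.add_apply]
  ring

lemma hasDerivAt_expCosh (l t a : ℝ) : HasDerivAt (expCosh l t) (expCosh' l t a) a := by
  have h : HasDerivAt (fun a : ℝ ↦ (a : ℂ) + t * Complex.I) 1 a :=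
    (Complex.ofRealCLM.hasDerivAt (x := a)).add_const _
  refine ((hasDerivAt_expCosh_complex l (a + t * Complex.I)).comp a h).congr_deriv ?_
  rw [mul_one]
  rfl

lemma hasDerivAt_expCosh_height (l t a : ℝ) :
    HasDerivAt (fun t ↦ expCosh l t a) (expCosh' l t a * Complex.I) t := by
  have h : HasDerivAt (fun t : ℝ ↦ (a : ℂ) + t * Complex.I) (1 * Complex.I) t :=
    ((Complex.ofRealCLM.hasDerivAt (x := t)).mul_const _).const_add _
  refine ((hasDerivAt_expCosh_complex l (a + t * Complex.I)).comp t h).congr_deriv ?_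
  rw [one_mul]
  rfl

lemma continuous_expCosh (l t : ℝ) : Continuous (expCosh l t) := by unfold expCosh; fun_prop

lemma continuous_expCosh' (l t : ℝ) : Continuous (expCosh' l t) := by
  unfold expCosh' expCosh; fun_prop

lemma integrable_cosh_mul_exp_neg_cosh {ε : ℝ} (hε : 0 < ε) :
    Integrable fun a : ℝ ↦ (exp a + exp (-a)) * exp (-(ε * (exp a + exp (-a)))) := by
  refine ((integrable_exp_mul_sub_cosh 1 hε).add (integrable_exp_mul_sub_cosh (-1) hε)).congr
    (Eventually.of_forall fun a ↦ ?_)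
  simp only
  rw [Pi.add_apply, add_mul, ← exp_add, ← exp_add]
  congr 2 <;> ring

lemma integrable_expCosh {l : ℝ} (hl : 0 < l) {t : ℝ} (ht : 0 < cos t) :
    Integrable (expCosh l t) := by
  have h := integrable_exp_mul_sub_cosh 0 (mul_pos hl ht)
  refine h.mono' (continuous_expCosh l t).aestronglyMeasurable (Eventually.of_forall fun a ↦ ?_)
  rw [norm_expCosh, zero_mul, zero_sub]

lemma integrable_expCosh' {l : ℝ} (hl : 0 < l) {t : ℝ} (ht : 0 < cos t) :
    Integrable (expCosh' l t) := by
  have h := (integrable_cosh_mul_exp_neg_cosh (mul_pos hl ht)).const_mul l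
  exact h.mono' (continuous_expCosh' l t).aestronglyMeasurable
    (Eventually.of_forall fun a ↦ norm_expCosh'_le hl t a)

lemma hasDerivAt_integral_expCosh {l : ℝ} (hl : 0 < l) {t : ℝ} (ht : 0 < cos t) :
    HasDerivAt (fun t ↦ ∫ a, expCosh l t a) 0 t := by
  set ε := cos t / 2 with hε
  have hε0 : 0 < ε := half_pos ht
  have hs : {y : ℝ | ε < cos y} ∈ 𝓝 t :=
    continuous_cos.continuousAt.eventually_const_lt (by rw [hε]; linarith)
  have key := hasDerivAt_integral_of_dominated_loc_of_deriv_le (μ := volume)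
    (F := expCosh l) (F' := fun t a ↦ expCosh' l t a * Complex.I)
    (bound := fun a ↦ l * ((exp a + exp (-a)) * exp (-(l * ε * (exp a + exp (-a)))))) hs
    (Eventually.of_forall fun y ↦ (continuous_expCosh l y).aestronglyMeasurable)
    (integrable_expCosh hl ht)
    ((continuous_expCosh' l t).mul continuous_const).aestronglyMeasurable
    (Eventually.of_forall fun a y hy ↦ ?_)
    ((integrable_cosh_mul_exp_neg_cosh (mul_pos hl hε0)).const_mul l)
    (Eventually.of_forall fun a y _ ↦ hasDerivAt_expCosh_height l y a)
  · have h0 : ∫ a, expCosh' l t a * Complex.I = 0 := by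
      rw [integral_mul_const, integral_eq_zero_of_hasDerivAt_of_integrable
        (hasDerivAt_expCosh l t) (integrable_expCosh' hl ht) (integrable_expCosh hl ht), zero_mul]
    rw [h0] at key
    exact key.2
  · have hy : ε < cos y := hy
    rw [norm_mul, Complex.norm_I, mul_one]
    refine (norm_expCosh'_le hl y a).trans ?_
    gcongr

/-- Rotation of the ray of integration: the integral does not depend on the height of the line. -/
lemma integral_expCosh_eq {l : ℝ} (hl : 0 < l) {t : ℝ} (ht : |t| < π / 2) :
    ∫ a, expCosh l t a = ∫ a, expCosh l 0 a := by
  have hcos : ∀ y ∈ Ioo (-(π / 2)) (π / 2), 0 < cos y := fun y hy ↦ cos_pos_of_mem_Ioo hy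
  have hp := pi_pos
  exact isOpen_Ioo.is_const_of_deriv_eq_zero isPreconnected_Ioo
    (f := fun t ↦ ∫ a, expCosh l t a)
    (fun y hy ↦ (hasDerivAt_integral_expCosh hl (hcos y hy)).differentiableAt.differentiableWithinAt)
    (fun y hy ↦ (hasDerivAt_integral_expCosh hl (hcos y hy)).deriv)
    (abs_lt.1 ht) ⟨by linarith, by linarith⟩

/-- The integral is real: rotate the ray by `arg m`, then rescale by `‖m‖`. -/
lemma integral_exp_conj_pair {l : ℝ} (hl : 0 < l) {m : ℂ} (hm : 0 < m.re) :
    ∫ b : ℝ, Complex.exp (-(l * (Complex.exp b * m + Complex.exp (-b) * (starRingEnd ℂ) m))) =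
      ∫ b : ℝ, ((exp (-(l * (Complex.normSq m * exp b + exp (-b)))) : ℝ) : ℂ) := by
  have hm0 : m ≠ 0 := by rintro rfl; simp at hm
  have hn := norm_pos_iff.2 hm0
  have harg : |m.arg| < π / 2 := Complex.abs_arg_lt_pi_div_two_iff.2 (Or.inl hm)
  have hmexp : m = ‖m‖ * Complex.exp (m.arg * Complex.I) := (Complex.norm_mul_exp_arg_mul_I m).symm
  have hconj : (starRingEnd ℂ) m = ‖m‖ * Complex.exp (-(m.arg * Complex.I)) := by
    conv_lhs => rw [hmexp]
    rw [map_mul, Complex.conj_ofReal, ← Complex.exp_conj, map_mul, Complex.conj_I,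
      Complex.conj_ofReal, mul_neg]
  have h1 : ∀ b : ℝ, Complex.exp (-(l * (Complex.exp b * m + Complex.exp (-b) *
      (starRingEnd ℂ) m))) = expCosh (l * ‖m‖) m.arg b := by
    have h : ∀ (b : ℝ) (w w' : ℂ), w = ‖m‖ * Complex.exp (m.arg * Complex.I) →
        w' = ‖m‖ * Complex.exp (-(m.arg * Complex.I)) →
        Complex.exp (-(l * (Complex.exp b * w + Complex.exp (-b) * w'))) =
          expCosh (l * ‖m‖) m.arg b := by
      rintro b _ _ rfl rfl
      rw [expCosh, neg_add, Complex.exp_add, Complex.exp_add]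
      push_cast
      ring_nf
    exact fun b ↦ h b _ _ hmexp hconj
  simp_rw [h1]
  rw [integral_expCosh_eq (mul_pos hl hn) harg,
    ← integral_add_right_eq_self _ (Real.log ‖m‖)]
  congr 1
  funext b
  have e1 : Complex.exp ((Real.log ‖m‖ : ℝ) : ℂ) = ‖m‖ := by
    rw [← Complex.ofReal_exp, Real.exp_log hn]
  rw [expCosh]
  push_cast
  rw [zero_mul, add_zero, neg_add, Complex.exp_add, Complex.exp_add, Complex.exp_neg
    ((Real.log ‖m‖ : ℝ) : ℂ), e1, Complex.normSq_eq_norm_sq]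
  have hn' : (‖m‖ : ℂ) ≠ 0 := by exact_mod_cast hn.ne'
  congr 2
  push_cast
  field_simp

end Rotation

/-- `|e^{x/2} e^{iα} + e^{-x/2} e^{-iα}|²`. -/
noncomputable def pairNormSq (α x : ℝ) : ℝ := exp x + exp (-x) + 2 * cos (2 * α)

section Bessel

variable {α p s : ℝ}

/-- The integrand of `2 K_p(2 e^{iα} / s)` after the substitution `t = e^a`. -/
noncomputable def besselIntegrand (α p s a : ℝ) : ℂ :=
  Complex.exp (-(p * a) - 1 / s * ray α * (Complex.exp a + Complex.exp (-a)))

lemma two_mul_besselK_eq :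
    2 * besselK p (2 * Complex.exp (α * Complex.I) / s) = ∫ a : ℝ, besselIntegrand α p s a := by
  rw [besselK, ← mul_assoc, mul_one_div_cancel two_ne_zero, one_mul, integral_Ioi_eq_integral_exp]
  congr 1
  funext a
  rw [besselIntegrand, ← Real.exp_mul, Complex.ofReal_exp, Complex.ofReal_exp, ← Complex.exp_add,
    ← Complex.exp_add, one_div (exp a), ← Real.exp_neg]
  change _ = Complex.exp (-(p * a) - 1 / s * Complex.exp (α * Complex.I) * _)
  congr 1
  push_cast
  ring

lemma integrable_besselIntegrand (hα₁ : |α| < π / 2) (hs : 0 < s) :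
    Integrable (besselIntegrand α p s) := by
  have h := integrable_exp_mul_sub_cosh (-p) (mul_pos (one_div_pos.2 hs) (cos_pos_of_angle hα₁))
  refine h.mono' (by unfold besselIntegrand; fun_prop) (Eventually.of_forall fun a ↦ ?_)
  rw [besselIntegrand, Complex.norm_exp]
  apply le_of_eq
  congr 1
  have e : (-(p * a) - 1 / s * ray α * (Complex.exp a + Complex.exp (-a)) : ℂ) =
      ((-(p * a) : ℝ) : ℂ) - ((1 / s * (exp a + exp (-a)) : ℝ) : ℂ) * ray α := by
    push_cast; ring
  rw [e, Complex.sub_re, Complex.ofReal_re, Complex.re_ofReal_mul, ray_re]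
  ring

/-- The integrand of the convolution is a conjugate pair once the integration variable is shifted
by `x / 2`. -/
lemma convolution_besselIntegrand (hα₁ : |α| < π / 2) (hs : 0 < s) (x : ℝ) :
    ∫ t : ℝ, besselIntegrand α p s t * (starRingEnd ℂ) (besselIntegrand α p s (x - t)) =
      ((exp (-(p * x)) * ∫ b : ℝ, exp (-(1 / s * (pairNormSq α x * exp b + exp (-b)))) : ℝ) : ℂ)
      := by
  set m : ℂ := Complex.exp (x / 2) * ray α + Complex.exp (-(x / 2)) * ray (-α) with hm
  have hc := cos_pos_of_angle hα₁
  have hm' : m = ((exp (x / 2) : ℝ) : ℂ) * ray α + ((exp (-(x / 2)) : ℝ) : ℂ) * ray (-α) := by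
    rw [hm]; push_cast; rfl
  have hre : m.re = (exp (x / 2) + exp (-(x / 2))) * cos α := by
    rw [hm', Complex.add_re, Complex.re_ofReal_mul, Complex.re_ofReal_mul, ray_re, ray_re, cos_neg]
    ring
  have him : m.im = (exp (x / 2) - exp (-(x / 2))) * sin α := by
    rw [hm', Complex.add_im, Complex.im_ofReal_mul, Complex.im_ofReal_mul, ray_im, ray_im, sin_neg]
    ring
  have hpos : 0 < m.re := by rw [hre]; positivity
  have hsq : Complex.normSq m = pairNormSq α x := by
    have e1 : exp (x / 2) ^ 2 = exp x := by rw [← exp_nat_mul]; congr 1; push_cast; ring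
    have e2 : exp (-(x / 2)) ^ 2 = exp (-x) := by rw [← exp_nat_mul]; congr 1; push_cast; ring
    have e3 : exp (x / 2) * exp (-(x / 2)) = 1 := by rw [← exp_add]; simp
    have e4 := sin_sq_add_cos_sq α
    rw [Complex.normSq_apply, hre, him, pairNormSq, cos_two_mul', ← e1, ← e2]
    linear_combination (exp (x / 2) ^ 2 + exp (-(x / 2)) ^ 2) * e4 +
      2 * (cos α ^ 2 - sin α ^ 2) * e3
  have hray : (starRingEnd ℂ) (ray α) = ray (-α) := by
    rw [ray, ray, ← Complex.exp_conj, map_mul, Complex.conj_I, Complex.conj_ofReal]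
    push_cast; ring_nf
  have hray' : (starRingEnd ℂ) (ray (-α)) = ray α := by rw [← hray, Complex.conj_conj]
  have hconj : (starRingEnd ℂ) m =
      Complex.exp (x / 2) * ray (-α) + Complex.exp (-(x / 2)) * ray α := by
    rw [hm', map_add, map_mul, map_mul, Complex.conj_ofReal, Complex.conj_ofReal, hray, hray']
    push_cast; rfl
  have hl : 0 < 1 / s := one_div_pos.2 hs
  rw [← integral_add_right_eq_self _ (x / 2)]
  have hint : ∀ b : ℝ, besselIntegrand α p s (b + x / 2) *
      (starRingEnd ℂ) (besselIntegrand α p s (x - (b + x / 2))) =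
      ((exp (-(p * x)) : ℝ) : ℂ) * Complex.exp (-((1 / s : ℝ) *
        (Complex.exp b * m + Complex.exp (-b) * (starRingEnd ℂ) m))) := by
    intro b
    have e5 : (starRingEnd ℂ) (besselIntegrand α p s (x - (b + x / 2))) =
        Complex.exp (-(p * (x / 2 - b)) - 1 / s * ray (-α) *
          (Complex.exp (x / 2 - b) + Complex.exp (-(x / 2 - b)))) := by
      have e6 : besselIntegrand α p s (x - (b + x / 2)) =
          Complex.exp (((-(p * (x / 2 - b)) : ℝ) : ℂ) -
            ((1 / s * (exp (x / 2 - b) + exp (-(x / 2 - b))) : ℝ) : ℂ) * ray α) := by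
        rw [besselIntegrand]; congr 1; push_cast; ring_nf
      rw [e6, ← Complex.exp_conj, map_sub, map_mul, Complex.conj_ofReal, Complex.conj_ofReal, hray]
      congr 1; push_cast; ring
    rw [e5, besselIntegrand, ← Complex.exp_add, Complex.ofReal_exp, ← Complex.exp_add, hconj, hm]
    congr 1
    push_cast
    have f1 : Complex.exp ((b : ℂ) + x / 2) = Complex.exp b * Complex.exp (x / 2) :=
      Complex.exp_add _ _
    have f2 : Complex.exp (-((b : ℂ) + x / 2)) = Complex.exp (-b) * Complex.exp (-(x / 2)) := by
      rw [← Complex.exp_add]; ring_nf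
    have f3 : Complex.exp ((x : ℂ) / 2 - b) = Complex.exp (x / 2) * Complex.exp (-b) := by
      rw [← Complex.exp_add]; ring_nf
    have f4 : Complex.exp (-((x : ℂ) / 2 - b)) = Complex.exp (-(x / 2)) * Complex.exp b := by
      rw [← Complex.exp_add]; ring_nf
    rw [f1, f2, f3, f4]
    ring
  simp_rw [hint]
  rw [integral_const_mul, integral_exp_conj_pair hl hpos, integral_complex_ofReal, hsq,
    Complex.ofReal_mul]

lemma pairNormSq_pos (hα₀ : 0 < |α|) (hα₁ : |α| < π / 2) (x : ℝ) : 0 < pairNormSq α x := by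
  have h := (abs_lt.1 (abs_cos_two_mul_lt_one hα₀ hα₁)).1
  have h1 : 1 ≤ cosh x := one_le_cosh x
  rw [cosh_eq] at h1
  rw [pairNormSq]
  linarith

lemma integrable_exp_neg_pair {q : ℝ} (hq : 0 < q) {l : ℝ} (hl : 0 < l) :
    Integrable fun b : ℝ ↦ exp (-(l * (q * exp b + exp (-b)))) := by
  have hm : 0 < min (l * q) l := lt_min (mul_pos hl hq) hl
  refine (integrable_exp_mul_sub_cosh 0 hm).mono' (by fun_prop) (Eventually.of_forall fun b ↦ ?_)
  rw [Real.norm_of_nonneg (exp_pos _).le, exp_le_exp, zero_mul, zero_sub, neg_le_neg_iff]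
  have h1 := mul_le_mul_of_nonneg_right (min_le_left (l * q) l) (exp_pos b).le
  have h2 := mul_le_mul_of_nonneg_right (min_le_right (l * q) l) (exp_pos (-b)).le
  linarith

/-- The product formula `|2 K_p(2 e^{iα} / s)|² = ∬ e^{-px} exp (-(|m(x)|² e^b + e^{-b}) / s)`. -/
lemma ofReal_besselNorm_eq (hα₀ : 0 < |α|) (hα₁ : |α| < π / 2) (hs : 0 < s) :
    ENNReal.ofReal (besselNorm α p s) = ∫⁻ x : ℝ, ∫⁻ b : ℝ, ENNReal.ofReal
      (exp (-(p * x)) * exp (-(1 / s * (pairNormSq α x * exp b + exp (-b))))) := by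
  set φ := besselIntegrand α p s
  have hφ : Integrable φ := integrable_besselIntegrand hα₁ hs
  have hφ' : Integrable fun a ↦ (starRingEnd ℂ) (φ a) :=
    Complex.conjCLE.toContinuousLinearMap.integrable_comp hφ
  set L := ContinuousLinearMap.mul ℂ ℂ
  set J : ℝ → ℝ := fun x ↦
    exp (-(p * x)) * ∫ b : ℝ, exp (-(1 / s * (pairNormSq α x * exp b + exp (-b)))) with hJ
  have hconv : convolution φ (fun a ↦ (starRingEnd ℂ) (φ a)) L volume = fun x ↦ (J x : ℂ) := by
    funext x
    rw [convolution_def]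
    exact convolution_besselIntegrand hα₁ hs x
  have hint := hφ.integrable_convolution L hφ'
  have h1 := integral_convolution L hφ hφ' (μ := volume) (ν := volume)
  rw [hconv] at hint h1
  have hJint : Integrable J := by simpa using hint.re
  have hJ0 : 0 ≤ J := fun x ↦ mul_nonneg (exp_pos _).le (integral_nonneg fun b ↦ (exp_pos _).le)
  have h2 : besselNorm α p s = ∫ x, J x := by
    rw [integral_complex_ofReal, integral_conj] at h1
    change _ = (∫ x, φ x) * _ at h1
    rw [Complex.mul_conj, Complex.normSq_eq_norm_sq, ← two_mul_besselK_eq] at h1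
    exact (Complex.ofReal_injective h1).symm
  rw [h2, ofReal_integral_eq_lintegral_ofReal hJint (Eventually.of_forall hJ0)]
  congr 1
  funext x
  simp only [hJ]
  rw [← integral_const_mul, ofReal_integral_eq_lintegral_ofReal]
  · exact (integrable_exp_neg_pair (pairNormSq_pos hα₀ hα₁ x) (one_div_pos.2 hs)).const_mul _
  · exact Eventually.of_forall fun b ↦ by positivity

lemma continuous_pairNormSq (α : ℝ) : Continuous (pairNormSq α) := by
  unfold pairNormSq; fun_prop

lemma besselNorm_pos (hα₀ : 0 < |α|) (hα₁ : |α| < π / 2) (hs : 0 < s) :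
    0 < besselNorm α p s := by
  rw [← ENNReal.ofReal_pos, ofReal_besselNorm_eq hα₀ hα₁ hs, pos_iff_ne_zero]
  have hc := continuous_pairNormSq α
  rw [← lintegral_prod (μ := volume) (ν := volume) (fun y : ℝ × ℝ ↦ ENNReal.ofReal
    (exp (-(p * y.1)) * exp (-(1 / s * (pairNormSq α y.1 * exp y.2 + exp (-y.2))))))
    (by fun_prop)]
  intro h
  rw [lintegral_eq_zero_iff (by fun_prop)] at h
  obtain ⟨y, hy⟩ := h.exists
  simp only [Pi.zero_apply, ENNReal.ofReal_eq_zero] at hy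
  have : 0 < exp (-(p * y.1)) * exp (-(1 / s * (pairNormSq α y.1 * exp y.2 + exp (-y.2)))) := by
    positivity
  linarith

end Bessel

/-! ### Normalization of the density -/

section Normalization

variable {α p s : ℝ} (hα₀ : 0 < |α|) (hα₁ : |α| < π / 2)

/-- The coordinate map `z ↦ u + i v`. -/
noncomputable def coordMap (α : ℝ) : ℂ →ₗ[ℝ] ℂ where
  toFun z := ⟨cu α z, cv α z⟩
  map_add' x y := by
    apply Complex.ext <;> simp only [cu, cv, Complex.add_re, Complex.add_im] <;> ring
  map_smul' r x := by
    apply Complex.ext <;> simp [cu, cv] <;> ring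

lemma det_coordMap (α : ℝ) : LinearMap.det (coordMap α) =
    -(2 * sin α * cos α) / sin (2 * α) ^ 2 := by
  rw [← LinearMap.det_toMatrix Complex.basisOneI, Matrix.det_fin_two]
  simp [LinearMap.toMatrix_apply, coordMap, cu, cv]
  ring

include hα₀ hα₁

lemma map_coord_volume : (volume : Measure ℂ).map (fun z ↦ (cu α z, cv α z)) =
    ENNReal.ofReal |sin (2 * α)| • (volume : Measure (ℝ × ℝ)) := by
  have hS := sin_two_mul_ne_zero hα₀ hα₁
  have hdet : LinearMap.det (coordMap α) = -(sin (2 * α))⁻¹ := by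
    rw [det_coordMap, ← sin_two_mul]; field_simp
  have h1 : (volume : Measure ℂ).map (coordMap α) =
      ENNReal.ofReal |sin (2 * α)| • (volume : Measure ℂ) := by
    rw [Measure.map_linearMap_addHaar_eq_smul_addHaar volume
      (by rw [hdet]; exact neg_ne_zero.2 (inv_ne_zero hS)), hdet, inv_neg, inv_inv, abs_neg]
  have hm : Measurable (coordMap α) := (coordMap α).continuous_of_finiteDimensional.measurable
  have h2 : (fun z ↦ (cu α z, cv α z)) = Complex.measurableEquivRealProd ∘ coordMap α := rfl
  rw [h2, ← Measure.map_map Complex.measurableEquivRealProd.measurable hm, h1, Measure.map_smul,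
    Complex.volume_preserving_equiv_real_prod.map_eq]

lemma measurable_kern (hs : 0 < s) (a b : ℝ) :
    Measurable (kern (1 / s) (cos (2 * α)) a b) :=
  (contDiff_kern (one_div_pos.2 hs) (abs_cos_two_mul_lt_one hα₀ hα₁) a b).continuous.measurable

/-- The substitution `v = e^b`, `u = e^{x + b}` turns the mass of the kernel into the double integral
of the product formula. -/
lemma lintegral_kern (hs : 0 < s) :
    ∫⁻ x : ℝ × ℝ, ENNReal.ofReal (kern (1 / s) (cos (2 * α)) (-p - 1) (p - 1) x) =
      ENNReal.ofReal (besselNorm α p s) := by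
  have hm := measurable_kern hα₀ hα₁ hs (-p - 1) (p - 1)
  have hc := continuous_pairNormSq α
  have hIoi : ∀ F : ℝ → ENNReal, (∀ t, ¬ 0 < t → F t = 0) → ∫⁻ t, F t = ∫⁻ t in Ioi 0, F t := by
    intro F hF
    rw [← lintegral_indicator measurableSet_Ioi]
    congr 1
    funext t
    by_cases h : t ∈ Ioi (0 : ℝ)
    · rw [indicator_of_mem h]
    · rw [indicator_of_notMem h, hF t h]
  change ∫⁻ x : ℝ × ℝ, _ ∂(volume.prod volume) = _
  rw [lintegral_prod_symm _ (by fun_prop), ofReal_besselNorm_eq hα₀ hα₁ hs, hIoi]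
  swap
  · intro v hv
    simp [kern, hv]
  rw [lintegral_Ioi_eq_lintegral_exp, lintegral_lintegral_swap (by unfold Function.uncurry; fun_prop)]
  congr 1
  funext b
  rw [hIoi, lintegral_Ioi_eq_lintegral_exp, ← lintegral_const_mul _ (by fun_prop),
    ← lintegral_add_right_eq_self _ b]
  swap
  · intro u hu
    simp [kern, hu]
  congr 1
  funext x
  rw [← ENNReal.ofReal_mul (by positivity), ← ENNReal.ofReal_mul (by positivity),
    kern_of_pos (exp_pos _) (exp_pos _), ← Real.exp_mul, ← Real.exp_mul]
  congr 1
  rw [← exp_add, ← exp_add, ← exp_add, ← exp_add, ← exp_add]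
  refine congrArg Real.exp ?_
  rw [one_div (exp b), ← Real.exp_neg, ← Real.exp_nat_mul, ← Real.exp_sub, pairNormSq]
  have e1 : ((2 : ℕ) : ℝ) * b - (x + b) = -x + b := by push_cast; ring
  rw [e1, Real.exp_add x b, Real.exp_add (-x) b]
  ring

lemma lintegral_density (hs : 0 < s) :
    ∫⁻ z : ℂ, ENNReal.ofReal (density α p s z) = 1 := by
  have hm := measurable_kern hα₀ hα₁ hs (-p - 1) (p - 1)
  have hN := besselNorm_pos (p := p) hα₀ hα₁ hs
  have hS := abs_pos.2 (sin_two_mul_ne_zero hα₀ hα₁)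
  have h0 : 0 ≤ (|sin (2 * α)| * besselNorm α p s)⁻¹ := by positivity
  simp_rw [density_eq_kern hα₀ hα₁, ENNReal.ofReal_mul h0]
  have hcoord : Measurable fun z ↦ (cu α z, cv α z) :=
    ((continuous_cu α).prodMk (continuous_cv α)).measurable
  have hmc : Measurable fun z ↦ kern (1 / s) (cos (2 * α)) (-p - 1) (p - 1) (cu α z, cv α z) :=
    hm.comp hcoord
  rw [lintegral_const_mul _ hmc.ennreal_ofReal,
    ← lintegral_map (f := fun x ↦ ENNReal.ofReal (kern (1 / s) (cos (2 * α)) (-p - 1) (p - 1) x))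
      (g := fun z ↦ (cu α z, cv α z)) hm.ennreal_ofReal hcoord,
    map_coord_volume hα₀ hα₁, lintegral_smul_measure, lintegral_kern hα₀ hα₁ hs, smul_eq_mul,
    ← ENNReal.ofReal_mul hS.le, ← ENNReal.ofReal_mul h0, inv_mul_cancel₀ (by positivity),
    ENNReal.ofReal_one]

lemma isProbabilityMeasure_nu (hs : 0 < s) : IsProbabilityMeasure (nu α p s) :=
  ⟨by rw [nu, withDensity_apply _ MeasurableSet.univ, Measure.restrict_univ,
    lintegral_density hα₀ hα₁ hs]⟩

end Normalization

/-! ### Stationarity of the density -/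

lemma lintegral_gammaPDF_mul (p k : ℝ) (G : ℝ → ENNReal) :
    ∫⁻ t, gammaPDF p k t * G t = ∫⁻ t in Ioi 0, gammaPDF p k t * G t := by
  rw [← lintegral_indicator measurableSet_Ioi]
  refine lintegral_congr_ae ?_
  filter_upwards [Measure.ae_ne volume (0 : ℝ)] with t ht
  rcases lt_or_gt_of_ne ht with h | h
  · rw [gammaPDF_of_neg h, zero_mul, indicator_of_notMem (by simpa using h.le)]
  · rw [indicator_of_mem (by simpa using h)]

lemma image_sub_div_Ioi {U : ℝ} (hU : 0 < U) :
    (fun y : ℝ ↦ U - U / (1 + U * y)) '' Ioi 0 = Ioo 0 U := by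
  ext t
  constructor
  · rintro ⟨y, hy, rfl⟩
    have hy : 0 < y := hy
    have h1 : 0 < U * y := by positivity
    have h2 : U / (1 + U * y) < U := (div_lt_self hU (by linarith))
    have h3 : 0 < U / (1 + U * y) := by positivity
    exact ⟨by simpa using h2, by simpa using h3⟩
  · rintro ⟨h0, h1⟩
    have h2 : 0 < U - t := by linarith
    refine ⟨1 / (U - t) - 1 / U, ?_, ?_⟩
    · have : 1 / U < 1 / (U - t) := one_div_lt_one_div_of_lt h2 (by linarith)
      simpa using this
    · have h3 : 1 + U * (1 / (U - t) - 1 / U) = U / (U - t) := by field_simp; ring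
      simp only [h3]
      field_simp
      ring

/-- The one-dimensional integral behind the stationarity of `f_α`. The substitution
`t = U - U / (1 + U y)`, that is `y = 1 / (U - t) - 1 / U`, turns it into a gamma integral. -/
lemma lintegral_gammaPDF_mul_kern {p k d U V : ℝ} (hp : 0 < p) (hk : 0 < k) (hU : 0 < U)
    (hV : 0 < V) :
    ∫⁻ t, gammaPDF p k t * ENNReal.ofReal (kern k d (-p - 1) (p - 1) (U - t, V)) =
      ENNReal.ofReal (U ^ (p - 1) * V ^ (-p - 1) *
        exp (-(k * (1 / V + U + V ^ 2 / U + 2 * V * d)))) := by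
  set A := U ^ (p - 1) * V ^ (-p - 1) * exp (-(k * (1 / V + U + V ^ 2 / U + 2 * V * d))) with hA
  have hA0 : 0 ≤ A := by positivity
  have hkV : 0 < k * V ^ 2 := by positivity
  have h1 : ∫⁻ t, gammaPDF p k t * ENNReal.ofReal (kern k d (-p - 1) (p - 1) (U - t, V)) =
      ∫⁻ t in Ioo 0 U, gammaPDF p k t * ENNReal.ofReal (kern k d (-p - 1) (p - 1) (U - t, V)) := by
    rw [lintegral_gammaPDF_mul, ← lintegral_indicator measurableSet_Ioi,
      ← lintegral_indicator measurableSet_Ioo]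
    congr 1
    funext t
    by_cases h0 : t ∈ Ioi (0 : ℝ)
    · by_cases h1 : t < U
      · have h2 : t ∈ Ioo 0 U := ⟨h0, h1⟩
        rw [indicator_of_mem h0, indicator_of_mem h2]
      · have : ¬ (0 < U - t) := by linarith
        rw [indicator_of_mem h0, indicator_of_notMem fun h ↦ h1 h.2]
        simp [kern, this]
    · rw [indicator_of_notMem h0, indicator_of_notMem fun h ↦ h0 h.1]
  have hderiv : ∀ y ∈ Ioi (0 : ℝ), HasDerivWithinAt (fun y : ℝ ↦ U - U / (1 + U * y))
      (U ^ 2 / (1 + U * y) ^ 2) (Ioi 0) y := by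
    intro y hy
    have hy : 0 < y := hy
    have hne : 1 + U * y ≠ 0 := by positivity
    have h2 : HasDerivAt (fun y : ℝ ↦ 1 + U * y) U y := by
      simpa using ((hasDerivAt_id y).const_mul U).const_add 1
    refine (((h2.fun_inv hne).const_mul U).const_sub U).hasDerivWithinAt.congr_deriv ?_
    field_simp
  have hinj : InjOn (fun y : ℝ ↦ U - U / (1 + U * y)) (Ioi 0) := by
    intro y hy z hz h
    have hy : 0 < y := hy
    have hz : 0 < z := hz
    have h2 : U / (1 + U * y) = U / (1 + U * z) := by
      have := h; simp only at this; linarith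
    rw [div_eq_div_iff (by positivity) (by positivity)] at h2
    have h3 : U * U * y = U * U * z := by linarith
    exact mul_left_cancel₀ (by positivity) h3
  rw [h1, ← image_sub_div_Ioi hU, lintegral_image_eq_lintegral_abs_deriv_mul measurableSet_Ioi
    hderiv hinj]
  have h2 : ∀ y ∈ Ioi (0 : ℝ), ENNReal.ofReal |U ^ 2 / (1 + U * y) ^ 2| *
      (gammaPDF p k (U - U / (1 + U * y)) *
        ENNReal.ofReal (kern k d (-p - 1) (p - 1) (U - (U - U / (1 + U * y)), V))) =
      ENNReal.ofReal A * (gammaPDF p (k * V ^ 2) y * 1) := by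
    intro y hy
    have hy : 0 < y := hy
    have hw : 0 < 1 + U * y := by positivity
    generalize hwdef : 1 + U * y = w at hw
    have ht : U - U / w = U ^ 2 * y / w := by
      field_simp; rw [← hwdef]; ring
    have ht0 : 0 < U ^ 2 * y / w := by positivity
    have hu0 : 0 < U / w := by positivity
    rw [sub_sub_cancel, ht, abs_of_pos (by positivity), gammaPDF_of_nonneg ht0.le,
      gammaPDF_of_nonneg hy.le, kern_of_pos hu0 hV, mul_one, ← ENNReal.ofReal_mul (by positivity),
      ← ENNReal.ofReal_mul (by positivity), ← ENNReal.ofReal_mul hA0]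
    congr 1
    -- all powers are written as exponentials, so that only their exponents need comparison
    have e1 : U ^ 2 / w ^ 2 = exp (2 * log U - 2 * log w) := by
      rw [exp_sub, two_mul, two_mul, exp_add, exp_add, exp_log hU, exp_log hw, sq, sq]
    have e2 : log (U ^ 2 * y / w) = 2 * log U + log y - log w := by
      rw [log_div (by positivity) hw.ne', log_mul (by positivity) hy.ne', log_pow]; push_cast; ring
    have e3 : log (U / w) = log U - log w := log_div hU.ne' hw.ne'
    have e4 : (k * V ^ 2) ^ p = k ^ p * exp (2 * log V * p) := by
      rw [mul_rpow hk.le (by positivity), rpow_def_of_pos (x := V ^ 2) (by positivity), log_pow]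
      push_cast; rfl
    have e5 : U ^ 2 * y / w + U / w = U := by
      rw [← ht]; ring
    have e6 : V ^ 2 / (U / w) = V ^ 2 / U + V ^ 2 * y := by
      rw [← hwdef]; field_simp
    have e7 : -(k * (1 / V + U / w + V ^ 2 / (U / w) + 2 * V * d)) = -(k * (1 / V + U + V ^ 2 / U +
        2 * V * d)) + k * (U ^ 2 * y / w) - k * V ^ 2 * y := by
      rw [e6]; linear_combination -k * e5
    rw [hA, e1, e4, e7, rpow_def_of_pos ht0, rpow_def_of_pos hu0, rpow_def_of_pos hV,
      rpow_def_of_pos hU, rpow_def_of_pos hV, rpow_def_of_pos hy, e2, e3]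
    generalize U ^ 2 * y / w = t
    generalize -(k * (1 / V + U + V ^ 2 / U + 2 * V * d)) = E
    have e8 : exp (2 * log U - 2 * log w) * exp ((2 * log U + log y - log w) * (p - 1)) *
        exp (-(k * t)) * exp ((log U - log w) * (-p - 1)) * exp (log V * (p - 1)) *
        exp (E + k * t - k * V ^ 2 * y) =
        exp (log U * (p - 1)) * exp (log V * (-p - 1)) * exp E * exp (2 * log V * p) *
        exp (log y * (p - 1)) * exp (-(k * V ^ 2 * y)) := by
      simp only [← exp_add]
      congr 1
      ring
    linear_combination k ^ p / Real.Gamma p * e8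
  rw [setLIntegral_congr_fun measurableSet_Ioi h2, lintegral_const_mul' _ _ ENNReal.ofReal_ne_top,
    ← lintegral_gammaPDF_mul]
  simp only [mul_one]
  rw [lintegral_gammaPDF_eq_one hp hkV, mul_one]

/-- The Jacobian of the inversion is `|w|⁻⁴`; the origin is a null set. -/
lemma lintegral_complex_inv {H : ℂ → ENNReal} :
    ∫⁻ w : ℂ, ENNReal.ofReal ((Complex.normSq w ^ 2)⁻¹) * H w⁻¹ = ∫⁻ w : ℂ, H w := by
  have hae : ∀ F : ℂ → ENNReal, ∫⁻ w in ({0}ᶜ : Set ℂ), F w = ∫⁻ w, F w := fun F ↦ by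
    rw [restrict_compl_singleton]
  have himg : (fun w : ℂ ↦ w⁻¹) '' ({0}ᶜ : Set ℂ) = {0}ᶜ := by
    ext w
    constructor
    · rintro ⟨y, hy, rfl⟩
      exact inv_ne_zero hy
    · intro hw
      exact ⟨w⁻¹, inv_ne_zero hw, inv_inv w⟩
  have hdet : ∀ c : ℂ, (((1 : ℂ →L[ℂ] ℂ).smulRight c).restrictScalars ℝ).det =
      Complex.normSq c := by
    intro c
    change LinearMap.det (((1 : ℂ →L[ℂ] ℂ).smulRight c).restrictScalars ℝ : ℂ →ₗ[ℝ] ℂ) = _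
    rw [← LinearMap.det_toMatrix Complex.basisOneI, Matrix.det_fin_two]
    simp [LinearMap.toMatrix_apply, Complex.normSq_apply]
  have hd : ∀ w ∈ ({0}ᶜ : Set ℂ), HasFDerivWithinAt (fun w : ℂ ↦ w⁻¹)
      (((1 : ℂ →L[ℂ] ℂ).smulRight (-(w ^ 2)⁻¹)).restrictScalars ℝ) {0}ᶜ w := fun w hw ↦
    ((hasDerivAt_inv hw).hasFDerivAt.restrictScalars ℝ).hasFDerivWithinAt
  rw [← hae H, ← himg, lintegral_image_eq_lintegral_abs_det_fderiv_mul volume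
    (measurableSet_singleton _).compl hd inv_injective.injOn, ← hae]
  refine setLIntegral_congr_fun (measurableSet_singleton _).compl fun w hw ↦ ?_
  rw [hdet, Complex.normSq_neg, map_inv₀, map_pow, abs_of_nonneg (inv_nonneg.2
    (sq_nonneg _))]

/-- One step of the continued fraction, the action of the matrix `(0, 1; 1, t e^{iα})` on `ℂ`. -/
noncomputable def step (α : ℝ) (x : ℂ) (t : ℝ) : ℂ := (x + t * ray α)⁻¹

lemma measurable_step (α : ℝ) : Measurable fun y : ℂ × ℝ ↦ step α y.1 y.2 := by
  unfold step
  exact (measurable_fst.add ((Complex.measurable_ofReal.comp measurable_snd).mul_const _)).inv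

section Stationary

variable {α p s : ℝ} (hα₀ : 0 < |α|) (hα₁ : |α| < π / 2) (hp : 0 < p) (hs : 0 < s)

include hα₀ hα₁ hs

lemma measurable_density : Measurable (density α p s) :=
  (contDiff_density hα₀ hα₁ hs).continuous.measurable

include hp

/-- Averaging the translates of `f_α` gives the density of `1 / Z` where `Z` has density `f_α`. -/
lemma lintegral_gammaPDF_mul_density (w : ℂ) :
    ∫⁻ t : ℝ, gammaPDF p (1 / s) t * ENNReal.ofReal (density α p s (w - t * ray α)) =
      ENNReal.ofReal ((Complex.normSq w ^ 2)⁻¹) * ENNReal.ofReal (density α p s w⁻¹) := by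
  have hk : 0 < 1 / s := one_div_pos.2 hs
  have hN := besselNorm_pos (p := p) hα₀ hα₁ hs
  have hS := abs_pos.2 (sin_two_mul_ne_zero hα₀ hα₁)
  have h0 : 0 ≤ (|sin (2 * α)| * besselNorm α p s)⁻¹ := by positivity
  have hsub : ∀ t : ℝ, w - t * ray α = w + ((-t : ℝ) : ℂ) * ray α := fun t ↦ by push_cast; ring
  simp_rw [density_eq_kern hα₀ hα₁, hsub, cu_add_ray hα₀ hα₁, cv_add_ray, cu_inv, cv_inv,
    ENNReal.ofReal_mul h0, ← sub_eq_add_neg, mul_left_comm (gammaPDF _ _ _)]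
  rw [lintegral_const_mul' _ _ ENNReal.ofReal_ne_top, mul_left_comm (ENNReal.ofReal _)]
  congr 1
  by_cases h : 0 < cu α w ∧ 0 < cv α w
  · obtain ⟨hU, hV⟩ := h
    rw [lintegral_gammaPDF_mul_kern hp hk hU hV, ← ENNReal.ofReal_mul (by positivity)]
    have hw : w ≠ 0 := ((coord_pos_iff hα₀ hα₁ w).2 ⟨hU, hV⟩).1
    have hR : 0 < Complex.normSq w := Complex.normSq_pos.2 hw
    have hR' := normSq_eq_coord hα₀ hα₁ w
    rw [kern_of_pos (by positivity) (by positivity)]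
    set U := cu α w
    set V := cv α w
    set R := Complex.normSq w
    congr 1
    have e1 : (V / R) ^ (-p - 1) = V ^ (-p - 1) * exp (log R * (p + 1)) := by
      rw [div_rpow hV.le hR.le, rpow_def_of_pos hR, div_eq_mul_inv, ← exp_neg]
      congr 2; ring
    have e2 : (U / R) ^ (p - 1) = U ^ (p - 1) * exp (-(log R * (p - 1))) := by
      rw [div_rpow hU.le hR.le, rpow_def_of_pos hR, div_eq_mul_inv, ← exp_neg]
    have e3 : exp (log R * (p + 1)) * exp (-(log R * (p - 1))) = R ^ 2 := by
      rw [← exp_add, sq]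
      conv_rhs => rw [← exp_log hR, ← exp_add]
      congr 1; ring
    have e4 : 1 / (U / R) + V / R + (U / R) ^ 2 / (V / R) + 2 * (U / R) * cos (2 * α) =
        1 / V + U + V ^ 2 / U + 2 * V * cos (2 * α) := by
      have f1 : V / R + (U / R) ^ 2 / (V / R) + 2 * (U / R) * cos (2 * α) = 1 / V := by
        have : V / R + (U / R) ^ 2 / (V / R) + 2 * (U / R) * cos (2 * α) =
          (U ^ 2 + V ^ 2 + 2 * (U * V) * cos (2 * α)) / (R * V) := by field_simp; ring
        rw [this, ← hR']; field_simp
      have f2 : 1 / (U / R) = U + V ^ 2 / U + 2 * V * cos (2 * α) := by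
        rw [one_div_div, hR']; field_simp
      linarith
    rw [e4, e1, e2]
    have hR2 : (R ^ 2)⁻¹ * R ^ 2 = 1 := inv_mul_cancel₀ (by positivity)
    generalize exp (-(1 / s * (1 / V + U + V ^ 2 / U + 2 * V * cos (2 * α)))) = E
    linear_combination (-(R ^ 2)⁻¹ * V ^ (-p - 1) * U ^ (p - 1) * E) * e3 -
      V ^ (-p - 1) * U ^ (p - 1) * E * hR2
  · have h1 : kern (1 / s) (cos (2 * α)) (-p - 1) (p - 1)
        (cv α w / Complex.normSq w, cu α w / Complex.normSq w) = 0 := by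
      rw [kern, if_neg]
      rintro ⟨h1, h2⟩
      refine h ⟨?_, ?_⟩
      · by_contra! hc
        exact h2.not_ge (div_nonpos_of_nonpos_of_nonneg hc (Complex.normSq_nonneg w))
      · by_contra! hc
        exact h1.not_ge (div_nonpos_of_nonpos_of_nonneg hc (Complex.normSq_nonneg w))
    rw [h1, ENNReal.ofReal_zero, mul_zero, lintegral_gammaPDF_mul,
      setLIntegral_congr_fun (g := fun _ ↦ 0) measurableSet_Ioi, lintegral_zero]
    intro t ht
    have ht : 0 < t := ht
    have : ¬ (0 < cu α w - t ∧ 0 < cv α w) := fun h' ↦ h ⟨by linarith [h'.1], h'.2⟩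
    simp only [kern, if_neg this, ENNReal.ofReal_zero, mul_zero]

/-- `f_α` is the density of a stationary law of the chain `x ↦ 1 / (x + a e^{iα})`. -/
lemma map_step_nu :
    ((nu α p s).prod (gammaMeasure p (1 / s))).map (fun y ↦ step α y.1 y.2) = nu α p s := by
  have := isProbabilityMeasure_nu (p := p) hα₀ hα₁ hs
  have := isProbabilityMeasure_gammaMeasure hp (one_div_pos.2 hs)
  have hf : Measurable fun z ↦ ENNReal.ofReal (density α p s z) :=
    (measurable_density hα₀ hα₁ hs).ennreal_ofReal
  have hg : Measurable (gammaPDF p (1 / s)) := (measurable_gammaPDFReal _ _).ennreal_ofReal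
  refine Measure.ext_of_lintegral _ fun F hF ↦ ?_
  have hFs : Measurable fun y : ℂ × ℝ ↦ F (step α y.1 y.2) := hF.comp (measurable_step α)
  rw [lintegral_map hF (measurable_step α), lintegral_prod_symm _ hFs.aemeasurable]
  have h1 : ∀ t : ℝ, ∫⁻ x, F (step α x t) ∂(nu α p s) =
      ∫⁻ w : ℂ, ENNReal.ofReal (density α p s (w - t * ray α)) * F w⁻¹ := by
    intro t
    have hFt : Measurable fun x ↦ F (step α x t) :=
      hFs.comp (measurable_id.prodMk measurable_const)
    rw [nu, lintegral_withDensity_eq_lintegral_mul _ hf hFt, ← lintegral_add_right_eq_self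
      (fun w : ℂ ↦ ENNReal.ofReal (density α p s (w - t * ray α)) * F w⁻¹) (t * ray α)]
    simp only [add_sub_cancel_right]
    rfl
  have hshift : Measurable fun y : ℝ × ℂ ↦ y.2 - y.1 * ray α :=
    measurable_snd.sub ((Complex.measurable_ofReal.comp measurable_fst).mul_const _)
  have hm : Measurable fun y : ℝ × ℂ ↦
      ENNReal.ofReal (density α p s (y.2 - y.1 * ray α)) * F y.2⁻¹ :=
    (hf.comp hshift).mul (hF.comp measurable_snd.inv)
  simp_rw [h1]
  rw [gammaMeasure, lintegral_withDensity_eq_lintegral_mul _ hg hm.lintegral_prod_right']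
  simp only [Pi.mul_apply]
  have h2 : ∀ t : ℝ, gammaPDF p (1 / s) t *
      ∫⁻ w : ℂ, ENNReal.ofReal (density α p s (w - t * ray α)) * F w⁻¹ =
      ∫⁻ w : ℂ, gammaPDF p (1 / s) t *
        (ENNReal.ofReal (density α p s (w - t * ray α)) * F w⁻¹) := fun t ↦
    (lintegral_const_mul _ (hm.comp (measurable_const.prodMk measurable_id))).symm
  simp_rw [h2]
  rw [lintegral_lintegral_swap ((hg.comp measurable_fst).mul hm).aemeasurable]
  have h3 : ∀ w : ℂ, ∫⁻ t : ℝ, gammaPDF p (1 / s) t *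
      (ENNReal.ofReal (density α p s (w - t * ray α)) * F w⁻¹) =
      ENNReal.ofReal ((Complex.normSq w ^ 2)⁻¹) *
        (ENNReal.ofReal (density α p s w⁻¹) * F w⁻¹) := by
    intro w
    simp_rw [← mul_assoc]
    rw [lintegral_mul_const, lintegral_gammaPDF_mul_density hα₀ hα₁ hp hs]
    exact hg.mul (hf.comp (hshift.comp (measurable_id.prodMk measurable_const)))
  simp_rw [h3]
  rw [lintegral_complex_inv (H := fun w ↦ ENNReal.ofReal (density α p s w) * F w), nu,
    lintegral_withDensity_eq_lintegral_mul _ hf hF]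
  rfl

end Stationary

/-! ### Convergence of the continued fraction -/

/-- Numerators of the convergents; the `n`-th convergent is `cfNum α a (n + 1) / cfDen α a (n + 1)`,
and the index `0` stands for the index `-1` of the customary numbering. -/
noncomputable def cfNum (α : ℝ) (a : ℕ → ℝ) : ℕ → ℂ
  | 0 => 1
  | 1 => 0
  | n + 2 => a n * ray α * cfNum α a (n + 1) + cfNum α a n

/-- Denominators of the convergents, with the same shift of the index as in `cfNum`. -/
noncomputable def cfDen (α : ℝ) (a : ℕ → ℝ) : ℕ → ℂ
  | 0 => 0
  | 1 => 1
  | n + 2 => a n * ray α * cfDen α a (n + 1) + cfDen α a n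

/-- The finite continued fraction whose last partial denominator `a_{n-1} e^{iα}` is augmented by
the tail `x`. -/
noncomputable def cfEval (α : ℝ) (a : ℕ → ℝ) : ℕ → ℂ → ℂ
  | 0, x => x
  | n + 1, x => cfEval α a n (step α x (a n))

lemma contsAux_contFrac (α : ℝ) (a : ℕ → ℝ) (n : ℕ) :
    (contFrac α a).contsAux n = ⟨cfNum α a n, cfDen α a n⟩ := by
  have hs : ∀ n, (contFrac α a).s.get? n = some ⟨1, a n * ray α⟩ := fun n ↦ rfl
  induction n using Nat.twoStepInduction with
  | zero => rfl
  | one => rfl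
  | more n ih1 ih2 =>
    rw [GenContFract.contsAux_recurrence (hs n) ih1 ih2]
    simp [cfNum, cfDen]

lemma convs_contFrac (α : ℝ) (a : ℕ → ℝ) (n : ℕ) :
    (contFrac α a).convs n = cfNum α a (n + 1) / cfDen α a (n + 1) := by
  rw [GenContFract.conv_eq_conts_a_div_conts_b, GenContFract.nth_cont_eq_succ_nth_contAux,
    contsAux_contFrac]

lemma cfEval_congr {α : ℝ} {a a' : ℕ → ℝ} {n : ℕ} (h : ∀ k < n, a k = a' k) (x : ℂ) :
    cfEval α a n x = cfEval α a' n x := by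
  induction n generalizing x with
  | zero => rfl
  | succ n ih =>
    rw [cfEval, cfEval, ih (fun k hk ↦ h k (by omega)), h n (by omega)]

/-- Up to the factor `|q_{n-1}|²`, the real part of `q_n / q_{n-1}`. The image of the right
half-plane under `cfEval α a n` is a disc of diameter the inverse of this quantity. -/
noncomputable def cfGap (α : ℝ) (a : ℕ → ℝ) (n : ℕ) : ℝ :=
  (cfDen α a (n + 1) * (starRingEnd ℂ) (cfDen α a n)).re

lemma cfGap_zero (α : ℝ) (a : ℕ → ℝ) : cfGap α a 0 = 0 := by simp [cfGap, cfDen]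

lemma cfGap_succ (α : ℝ) (a : ℕ → ℝ) (n : ℕ) :
    cfGap α a (n + 1) = a n * cos α * ‖cfDen α a (n + 1)‖ ^ 2 + cfGap α a n := by
  rw [cfGap, cfGap, cfDen, ← Complex.normSq_eq_norm_sq, Complex.normSq_apply, add_mul,
    Complex.add_re]
  simp only [Complex.mul_re, Complex.mul_im, Complex.conj_re, Complex.conj_im, Complex.ofReal_re,
    Complex.ofReal_im, ray_re, ray_im]
  ring

lemma cfGap_le_norm_mul (α : ℝ) (a : ℕ → ℝ) (n : ℕ) :
    cfGap α a n ≤ ‖cfDen α a (n + 1)‖ * ‖cfDen α a n‖ := by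
  refine (Complex.re_le_norm _).trans ?_
  rw [norm_mul, RCLike.norm_conj]

section Converge

variable {α : ℝ} (hα₁ : |α| < π / 2) {a : ℕ → ℝ} (ha : ∀ n, 0 < a n)

include hα₁

lemma re_add_ray_pos {x : ℂ} (hx : 0 ≤ x.re) {t : ℝ} (ht : 0 < t) :
    0 < (x + t * ray α).re := by
  rw [Complex.add_re, Complex.re_ofReal_mul, ray_re]
  have := cos_pos_of_angle hα₁
  positivity

lemma re_step_nonneg {x : ℂ} (hx : 0 ≤ x.re) {t : ℝ} (ht : 0 < t) : 0 ≤ (step α x t).re := by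
  rw [step, Complex.inv_re]
  exact div_nonneg (re_add_ray_pos hα₁ hx ht).le (Complex.normSq_nonneg _)

lemma add_ray_ne_zero {x : ℂ} (hx : 0 ≤ x.re) {t : ℝ} (ht : 0 < t) : x + t * ray α ≠ 0 := by
  intro h
  have := re_add_ray_pos hα₁ hx ht
  rw [h, Complex.zero_re] at this
  exact this.false

include ha

lemma cfEval_eq_div (n : ℕ) {x : ℂ} (hx : 0 ≤ x.re) :
    cfEval α a n x =
      (cfNum α a (n + 1) + cfNum α a n * x) / (cfDen α a (n + 1) + cfDen α a n * x) := by
  induction n generalizing x with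
  | zero => simp [cfEval, cfNum, cfDen]
  | succ n ih =>
    have h := add_ray_ne_zero hα₁ hx (ha n)
    rw [cfEval, ih (re_step_nonneg hα₁ hx (ha n)), ← mul_div_mul_right _ _ h, step, cfNum, cfDen,
      add_mul, add_mul, inv_mul_cancel_right₀ h, inv_mul_cancel_right₀ h]
    ring_nf

lemma norm_cfEval_sub_mul (n : ℕ) {x y : ℂ} (hx : 0 ≤ x.re) (hy : 0 ≤ y.re) :
    ‖cfEval α a n x - cfEval α a n y‖ * (‖cfDen α a (n + 1) + cfDen α a n * x‖ *
      ‖cfDen α a (n + 1) + cfDen α a n * y‖) = ‖x - y‖ := by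
  induction n generalizing x y with
  | zero => simp [cfEval, cfDen]
  | succ n ih =>
    have hx' := add_ray_ne_zero hα₁ hx (ha n)
    have hy' := add_ray_ne_zero hα₁ hy (ha n)
    have hQ : ∀ z : ℂ, z + a n * ray α ≠ 0 →
        cfDen α a (n + 2) + cfDen α a (n + 1) * z =
          (cfDen α a (n + 1) + cfDen α a n * step α z (a n)) * (z + a n * ray α) := by
      intro z hz
      rw [step, add_mul, inv_mul_cancel_right₀ hz, cfDen]
      ring
    have hd : x - y = (step α x (a n) - step α y (a n)) * ((x + a n * ray α) * (y + a n * ray α)) *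
        (-1) := by
      rw [step, step]
      field_simp
      ring
    rw [cfEval, cfEval, hQ x hx', hQ y hy', norm_mul, norm_mul, hd, norm_mul, norm_mul, norm_mul,
      norm_neg, norm_one, mul_one, ← ih (re_step_nonneg hα₁ hx (ha n))
      (re_step_nonneg hα₁ hy (ha n))]
    ring

omit hα₁ ha in
lemma cfGap_le_norm_mul_tail (n : ℕ) {x : ℂ} (hx : 0 ≤ x.re) :
    cfGap α a n ≤ ‖cfDen α a (n + 1) + cfDen α a n * x‖ * ‖cfDen α a n‖ := by
  have h : ((cfDen α a (n + 1) + cfDen α a n * x) * (starRingEnd ℂ) (cfDen α a n)).re =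
      cfGap α a n + Complex.normSq (cfDen α a n) * x.re := by
    rw [cfGap, add_mul, Complex.add_re, Complex.normSq_apply]
    congr 1
    simp only [Complex.mul_re, Complex.mul_im, Complex.conj_re, Complex.conj_im]
    ring
  calc cfGap α a n ≤ cfGap α a n + Complex.normSq (cfDen α a n) * x.re :=
        le_add_of_nonneg_right (mul_nonneg (Complex.normSq_nonneg _) hx)
    _ = _ := h.symm
    _ ≤ ‖(cfDen α a (n + 1) + cfDen α a n * x) * (starRingEnd ℂ) (cfDen α a n)‖ :=
        Complex.re_le_norm _
    _ = _ := by rw [norm_mul, RCLike.norm_conj]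

/-- The image of the right half-plane shrinks as `cfGap` grows. -/
lemma norm_cfEval_sub_le {n : ℕ} (hn : 0 < cfGap α a n) {x y : ℂ} (hx : 0 ≤ x.re)
    (hy : 0 ≤ y.re) : ‖cfEval α a n x - cfEval α a n y‖ ≤ 2 / cfGap α a n := by
  have h1 := cfGap_le_norm_mul_tail (α := α) (a := a) n hx
  have h2 := cfGap_le_norm_mul_tail (α := α) (a := a) n hy
  have h3 := norm_cfEval_sub_mul hα₁ ha n hx hy
  have h4 : ‖cfDen α a n‖ * ‖x - y‖ ≤ ‖cfDen α a (n + 1) + cfDen α a n * x‖ +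
      ‖cfDen α a (n + 1) + cfDen α a n * y‖ := by
    have e : cfDen α a n * (x - y) = (cfDen α a (n + 1) + cfDen α a n * x) -
      (cfDen α a (n + 1) + cfDen α a n * y) := by ring
    rw [← norm_mul, e]
    exact norm_sub_le _ _
  set X := ‖cfDen α a (n + 1) + cfDen α a n * x‖
  set Y := ‖cfDen α a (n + 1) + cfDen α a n * y‖
  set D := ‖cfDen α a n‖ with hD
  set g := cfGap α a n
  have hD0 : 0 < D := by
    rcases (norm_nonneg (cfDen α a n)).eq_or_lt with h | h
    · rw [hD, ← h, mul_zero] at h1; linarith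
    · exact h
  have hX0 : 0 < X := by
    by_contra! h; have := mul_nonpos_of_nonpos_of_nonneg h hD0.le; linarith
  have hY0 : 0 < Y := by
    by_contra! h; have := mul_nonpos_of_nonpos_of_nonneg h hD0.le; linarith
  rw [le_div_iff₀ hn]
  -- after multiplication by `D * X * Y` both terms are controlled by `g ≤ X * D` and `g ≤ Y * D`
  have h5 : ‖cfEval α a n x - cfEval α a n y‖ * g * (D * (X * Y)) ≤ 2 * (D * (X * Y)) := by
    calc _ = (D * ‖x - y‖) * g := by rw [← h3]; ring
      _ ≤ (X + Y) * g := by gcongr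
      _ = X * g + Y * g := by ring
      _ ≤ X * (Y * D) + Y * (X * D) := by gcongr
      _ = _ := by ring
  exact le_of_mul_le_mul_right h5 (by positivity)

lemma cfGap_mono : Monotone (cfGap α a) := by
  refine monotone_nat_of_le_succ fun n ↦ ?_
  rw [cfGap_succ]
  have := ha n
  have := cos_pos_of_angle hα₁
  have : 0 ≤ a n * cos α * ‖cfDen α a (n + 1)‖ ^ 2 := by positivity
  linarith

lemma cfGap_one_pos : 0 < cfGap α a 1 := by
  have := ha 0
  have := cos_pos_of_angle hα₁
  rw [cfGap_succ, cfGap_zero, cfDen, norm_one]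
  positivity

/-- Two consecutive terms are needed because `|q_n|` alone may be small, whereas
`|q_n| |q_{n-1}|` is bounded below by `cfGap`. -/
lemma cfGap_add_two_ge (n : ℕ) : cfGap α a n + 2 * cos α * cfGap α a 1 * min (a n) (a (n + 1)) ≤
    cfGap α a (n + 2) := by
  have h1 := cfGap_mono hα₁ ha (show 1 ≤ n + 1 by omega)
  have h2 := cfGap_le_norm_mul α a (n + 1)
  have hc := cos_pos_of_angle hα₁
  have hm : 0 < min (a n) (a (n + 1)) := lt_min (ha n) (ha (n + 1))
  rw [cfGap_succ α a (n + 1), cfGap_succ α a n]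
  set A := ‖cfDen α a (n + 1)‖
  set B := ‖cfDen α a (n + 1 + 1)‖
  set m := min (a n) (a (n + 1)) with hmdef
  have h3 : m * cos α * A ^ 2 ≤ a n * cos α * A ^ 2 := by gcongr; exact min_le_left _ _
  have h4 : m * cos α * B ^ 2 ≤ a (n + 1) * cos α * B ^ 2 := by gcongr; exact min_le_right _ _
  have h5 : cfGap α a 1 ≤ B * A := h1.trans h2
  have h6 : m * cos α * (2 * cfGap α a 1) ≤ m * cos α * (A ^ 2 + B ^ 2) := by
    gcongr
    nlinarith [sq_nonneg (A - B)]
  linarith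

lemma tendsto_cfGap (hsum : Tendsto (fun k ↦ ∑ j ∈ Finset.range k, min (a (2 * j)) (a (2 * j + 1)))
    atTop atTop) : Tendsto (cfGap α a) atTop atTop := by
  have hc := cos_pos_of_angle hα₁
  have h1 := cfGap_one_pos hα₁ ha
  have hlow : ∀ k, 2 * cos α * cfGap α a 1 *
      ∑ j ∈ Finset.range k, min (a (2 * j)) (a (2 * j + 1)) ≤ cfGap α a (2 * k) := by
    intro k
    induction k with
    | zero => simp [cfGap_zero]
    | succ k ih =>
      rw [Finset.sum_range_succ, mul_add]
      have := cfGap_add_two_ge hα₁ ha (2 * k)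
      rw [mul_add, mul_one]
      linarith
  refine tendsto_atTop_atTop_of_monotone (cfGap_mono hα₁ ha) fun b ↦ ?_
  have ht := hsum.const_mul_atTop (show 0 < 2 * cos α * cfGap α a 1 by positivity)
  obtain ⟨k, hk⟩ := (ht.eventually_ge_atTop b).exists
  exact ⟨2 * k, hk.trans (hlow k)⟩

lemma exists_cfEval_add_eq (n k : ℕ) {x : ℂ} (hx : 0 ≤ x.re) :
    ∃ y : ℂ, 0 ≤ y.re ∧ cfEval α a (n + k) x = cfEval α a n y := by
  induction k generalizing x with
  | zero => exact ⟨x, hx, rfl⟩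
  | succ k ih => exact ih (re_step_nonneg hα₁ hx (ha (n + k)))

/-- The nested images of the right half-plane shrink to a point, the value of the fraction. -/
lemma exists_tendsto_cfEval (hgap : Tendsto (cfGap α a) atTop atTop) :
    ∃ Z : ℂ, ∀ x : ℂ, 0 ≤ x.re → Tendsto (fun n ↦ cfEval α a n x) atTop (𝓝 Z) := by
  have hb : Tendsto (fun n ↦ 2 / cfGap α a n) atTop (𝓝 0) := hgap.const_div_atTop 2
  have h0 : (0 : ℝ) ≤ (0 : ℂ).re := le_rfl
  have hpos := hgap.eventually_gt_atTop 0
  have hcauchy : CauchySeq fun n ↦ cfEval α a n 0 := by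
    refine Metric.cauchySeq_iff'.2 fun ε hε ↦ ?_
    obtain ⟨N, hN, hN0⟩ := ((hb.eventually_lt_const hε).and hpos).exists
    refine ⟨N, fun n hn ↦ ?_⟩
    obtain ⟨k, rfl⟩ := Nat.exists_eq_add_of_le hn
    obtain ⟨y, hy, hk⟩ := exists_cfEval_add_eq hα₁ ha N k h0
    rw [hk, dist_eq_norm]
    exact (norm_cfEval_sub_le hα₁ ha hN0 hy h0).trans_lt hN
  obtain ⟨Z, hZ⟩ := cauchySeq_tendsto_of_complete hcauchy
  refine ⟨Z, fun x hx ↦ ?_⟩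
  have hd : Tendsto (fun n ↦ cfEval α a n x - cfEval α a n 0) atTop (𝓝 0) := by
    refine squeeze_zero_norm' ?_ hb
    filter_upwards [hpos] with n hn
    exact norm_cfEval_sub_le hα₁ ha hn hx h0
  simpa using hd.add hZ

lemma convs_eq_cfEval (n : ℕ) : (contFrac α a).convs n = cfEval α a n 0 := by
  rw [convs_contFrac, cfEval_eq_div hα₁ ha n le_rfl, mul_zero, mul_zero, add_zero, add_zero]

end Converge

/-! ### Stationary laws on the cone are the law of the continued fraction -/

lemma ae_gammaMeasure_pos (p k : ℝ) : ∀ᵐ t ∂(gammaMeasure p k), 0 < t := by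
  have hg : Measurable (gammaPDF p k) := (measurable_gammaPDFReal _ _).ennreal_ofReal
  rw [gammaMeasure, ae_withDensity_iff hg]
  filter_upwards [Measure.ae_ne volume (0 : ℝ)] with t ht h
  by_contra! hc
  exact h (gammaPDF_of_neg (lt_of_le_of_ne hc ht))

section Random

variable {Ω : Type*} [MeasurableSpace Ω] {P : Measure Ω} [IsProbabilityMeasure P]
  {a : ℕ → Ω → ℝ} (h_indep : iIndepFun a P) (hm : ∀ n, Measurable (a n))

include h_indep hm

/-- The law of large numbers for the bounded variables `min 1 (min a_{2j} a_{2j+1})`. -/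
lemma ae_tendsto_sum_min {γ : Measure ℝ} (h_law : ∀ n, P.map (a n) = γ)
    (hpos : ∀ᵐ w ∂P, ∀ n, 0 < a n w) :
    ∀ᵐ w ∂P, Tendsto (fun k ↦ ∑ j ∈ Finset.range k, min (a (2 * j) w) (a (2 * j + 1) w))
      atTop atTop := by
  set φ : ℝ × ℝ → ℝ := fun y ↦ min 1 (max 0 (min y.1 y.2)) with hφ
  have hφm : Measurable φ := by fun_prop
  set X : ℕ → Ω → ℝ := fun j w ↦ φ (a (2 * j) w, a (2 * j + 1) w) with hX
  have hpair : ∀ j, Measurable fun w ↦ (a (2 * j) w, a (2 * j + 1) w) := fun j ↦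
    (hm _).prodMk (hm _)
  have hXm : ∀ j, Measurable (X j) := fun j ↦ hφm.comp (hpair j)
  have hφ0 : ∀ y, 0 ≤ φ y := fun y ↦ le_min zero_le_one (le_max_left _ _)
  have hφ1 : ∀ y, φ y ≤ 1 := fun y ↦ min_le_left _ _
  have hint : Integrable (X 0) P := by
    refine Integrable.of_bound (hXm 0).aestronglyMeasurable 1 (Eventually.of_forall fun w ↦ ?_)
    rw [Real.norm_of_nonneg (hφ0 _)]
    exact hφ1 _
  have hind : Pairwise (Function.onFun (fun f g ↦ IndepFun f g P) X) := by
    intro i j hij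
    exact (h_indep.indepFun_prodMk_prodMk hm (2 * i) (2 * i + 1) (2 * j) (2 * j + 1)
      (by omega) (by omega) (by omega) (by omega)).comp hφm hφm
  have hlaw : ∀ j, P.map (fun w ↦ (a (2 * j) w, a (2 * j + 1) w)) = γ.prod γ := by
    intro j
    rw [(indepFun_iff_map_prod_eq_prod_map_map (hm _).aemeasurable (hm _).aemeasurable).1
      (h_indep.indepFun (show 2 * j ≠ 2 * j + 1 by omega)), h_law, h_law]
  have hident : ∀ i, IdentDistrib (X i) (X 0) P P := fun i ↦
    (IdentDistrib.mk (hpair i).aemeasurable (hpair 0).aemeasurable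
      ((hlaw i).trans (hlaw 0).symm)).comp hφm
  have hmean : 0 < ∫ w, X 0 w ∂P := by
    rw [integral_pos_iff_support_of_nonneg_ae (Eventually.of_forall fun w ↦ hφ0 _) hint]
    have : ∀ᵐ w ∂P, w ∈ Function.support (X 0) := by
      filter_upwards [hpos] with w hw
      have : 0 < X 0 w := lt_min one_pos (lt_max_of_lt_right (lt_min (hw _) (hw _)))
      exact this.ne'
    rw [pos_iff_ne_zero]
    intro h0
    have h2 : ∀ᵐ w ∂P, w ∉ Function.support (X 0) := measure_eq_zero_iff_ae_notMem.1 h0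
    obtain ⟨w, h3, h4⟩ := (this.and h2).exists
    exact h4 h3
  filter_upwards [strong_law_ae_real X hint hind hident, hpos] with w hw hwpos
  have h1 : Tendsto (fun n : ℕ ↦ (n : ℝ) * ((∑ i ∈ Finset.range n, X i w) / n)) atTop atTop :=
    tendsto_natCast_atTop_atTop.atTop_mul_pos hmean hw
  refine tendsto_atTop_mono' _ ?_ h1
  filter_upwards [eventually_gt_atTop 0] with n hn
  have hn' : (n : ℝ) ≠ 0 := by exact_mod_cast hn.ne'
  rw [mul_div_cancel₀ _ hn']
  refine Finset.sum_le_sum fun j _ ↦ (min_le_right _ _).trans (max_le ?_ le_rfl)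
  exact (lt_min (hwpos _) (hwpos _)).le

omit h_indep hm [IsProbabilityMeasure P] in
lemma measurable_cfEval (α : ℝ) (n : ℕ) :
    Measurable fun y : (ℕ → ℝ) × ℂ ↦ cfEval α y.1 n y.2 := by
  induction n with
  | zero => exact measurable_snd
  | succ n ih =>
    exact ih.comp (measurable_fst.prodMk ((measurable_step α).comp
      (measurable_snd.prodMk ((measurable_pi_apply n).comp measurable_fst))))

/-- A stationary law is preserved by any number of steps of the chain. The last step uses only
`a_n`, which is independent of the earlier ones. -/
lemma lintegral_cfEval_of_stationary {α : ℝ} {γ : Measure ℝ} [IsProbabilityMeasure γ]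
    (h_law : ∀ n, P.map (a n) = γ) {ρ : Measure ℂ} [IsProbabilityMeasure ρ]
    (hρ : (ρ.prod γ).map (fun y ↦ step α y.1 y.2) = ρ) (n : ℕ) {F : ℂ → ENNReal}
    (hF : Measurable F) :
    ∫⁻ w, ∫⁻ x, F (cfEval α (fun k ↦ a k w) n x) ∂ρ ∂P = ∫⁻ x, F x ∂ρ := by
  induction n with
  | zero => simp [cfEval]
  | succ n ih =>
    -- `tr w` keeps the variables used in the first `n` steps, so that it is independent of `a n`
    set tr : Ω → ℕ → ℝ := fun w k ↦ if k < n then a k w else 0 with htr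
    have htr_congr : ∀ w x, cfEval α (fun k ↦ a k w) n x = cfEval α (tr w) n x := fun w x ↦
      cfEval_congr (fun k hk ↦ by simp [htr, hk]) x
    have htrm : Measurable tr := measurable_pi_lambda _ fun k ↦ by
      by_cases h : k < n
      · simpa [htr, h] using hm k
      · simp [htr, h]
    have hindep : IndepFun tr (a n) P := by
      have h := h_indep.indepFun_finset (Finset.range n) {n} (by simp) hm
      have h1 : Measurable fun (y : Finset.range n → ℝ) (k : ℕ) ↦
          if hk : k ∈ Finset.range n then y ⟨k, hk⟩ else 0 := by
        refine measurable_pi_lambda _ fun k ↦ ?_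
        by_cases hk : k ∈ Finset.range n
        · simpa [hk] using measurable_pi_apply _
        · simp [hk]
      have h2 : Measurable fun y : ({n} : Finset ℕ) → ℝ ↦ y ⟨n, by simp⟩ := measurable_pi_apply _
      have h3 := h.comp h1 h2
      have e : tr = (fun (y : Finset.range n → ℝ) (k : ℕ) ↦
          if hk : k ∈ Finset.range n then y ⟨k, hk⟩ else 0) ∘
          fun w (i : Finset.range n) ↦ a i w := by
        funext w k
        by_cases hk : k < n
        · simp [htr, hk]
        · simp [htr, hk]
      rw [e]
      exact h3
    set H : (ℕ → ℝ) × ℝ → ENNReal := fun y ↦ ∫⁻ x, F (cfEval α y.1 n (step α x y.2)) ∂ρ with hH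
    have hbase : Measurable fun y : ((ℕ → ℝ) × ℝ) × ℂ ↦
        F (cfEval α y.1.1 n (step α y.2 y.1.2)) :=
      hF.comp ((measurable_cfEval α n).comp ((measurable_fst.comp measurable_fst).prodMk
        ((measurable_step α).comp (measurable_snd.prodMk (measurable_snd.comp measurable_fst)))))
    have hHm : Measurable H := hbase.lintegral_prod_right'
    have hFc : ∀ y, Measurable fun x ↦ F (cfEval α y n x) := fun y ↦
      hF.comp ((measurable_cfEval α n).comp (measurable_const.prodMk measurable_id))
    have hstat : ∀ y, ∫⁻ t, H (y, t) ∂γ = ∫⁻ x, F (cfEval α y n x) ∂ρ := by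
      intro y
      conv_rhs => rw [← hρ]
      rw [lintegral_map (hFc y) (measurable_step α), lintegral_prod_symm]
      exact ((hFc y).comp (measurable_step α)).aemeasurable
    have hFc2 : Measurable fun y ↦ ∫⁻ x, F (cfEval α y n x) ∂ρ :=
      (hF.comp (measurable_cfEval α n)).lintegral_prod_right'
    calc ∫⁻ w, ∫⁻ x, F (cfEval α (fun k ↦ a k w) (n + 1) x) ∂ρ ∂P
        = ∫⁻ w, H (tr w, a n w) ∂P := by
          simp only [cfEval, htr_congr, hH]
      _ = ∫⁻ y, H y ∂(P.map fun w ↦ (tr w, a n w)) :=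
          (lintegral_map hHm (htrm.prodMk (hm n))).symm
      _ = ∫⁻ y, ∫⁻ t, H (y, t) ∂γ ∂(P.map tr) := by
          have := Measure.isProbabilityMeasure_map (μ := P) htrm.aemeasurable
          rw [(indepFun_iff_map_prod_eq_prod_map_map htrm.aemeasurable
            (hm n).aemeasurable).1 hindep, h_law n, lintegral_prod _ hHm.aemeasurable]
      _ = ∫⁻ w, ∫⁻ x, F (cfEval α (tr w) n x) ∂ρ ∂P := by
          simp_rw [hstat]
          rw [lintegral_map hFc2 htrm]
      _ = ∫⁻ x, F x ∂ρ := by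
          rw [← ih]
          simp only [htr_congr]

/-- Let `n → ∞` in `lintegral_cfEval_of_stationary`: the limit of the finite fractions does not
depend on the tail `x`. -/
lemma map_eq_of_stationary {α : ℝ} {γ : Measure ℝ} [IsProbabilityMeasure γ]
    (h_law : ∀ n, P.map (a n) = γ) {ρ : Measure ℂ} [IsProbabilityMeasure ρ]
    (hρ : (ρ.prod γ).map (fun y ↦ step α y.1 y.2) = ρ) (hre : ∀ᵐ x ∂ρ, 0 ≤ x.re)
    {Z : Ω → ℂ} (hZ : Measurable Z) (hlim : ∀ᵐ w ∂P, ∀ x : ℂ, 0 ≤ x.re →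
      Tendsto (fun n ↦ cfEval α (fun k ↦ a k w) n x) atTop (𝓝 (Z w))) :
    P.map Z = ρ := by
  have := Measure.isProbabilityMeasure_map (μ := P) hZ.aemeasurable
  refine ext_of_forall_lintegral_eq_of_IsFiniteMeasure fun F ↦ ?_
  have hF : Measurable fun x ↦ (F x : ENNReal) := F.continuous.measurable.coe_nnreal_ennreal
  have hseq : Measurable fun y : Ω × ℂ ↦ ((fun k ↦ a k y.1 : ℕ → ℝ), y.2) :=
    (measurable_pi_lambda _ fun k ↦ (hm k).comp measurable_fst).prodMk measurable_snd
  have hFm : ∀ n, Measurable fun y : Ω × ℂ ↦ (F (cfEval α (fun k ↦ a k y.1) n y.2) : ENNReal) :=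
    fun n ↦ hF.comp ((measurable_cfEval α n).comp hseq)
  have hae : ∀ᵐ y ∂(P.prod ρ), Tendsto
      (fun n ↦ (F (cfEval α (fun k ↦ a k y.1) n y.2) : ENNReal)) atTop (𝓝 (F (Z y.1))) := by
    filter_upwards [Measure.quasiMeasurePreserving_fst.ae hlim,
      Measure.quasiMeasurePreserving_snd.ae hre] with y h1 h2
    exact ENNReal.tendsto_coe.2 ((F.continuous.tendsto _).comp (h1 _ h2))
  have hlim := tendsto_lintegral_of_dominated_convergence (μ := P.prod ρ)
    (fun _ ↦ (nndist F 0 : ENNReal)) hFm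
    (fun n ↦ Eventually.of_forall fun y ↦ ENNReal.coe_le_coe.2
      (BoundedContinuousFunction.NNReal.upper_bound F _))
    (by simp) hae
  have hconst : ∀ n, ∫⁻ y, (F (cfEval α (fun k ↦ a k y.1) n y.2) : ENNReal) ∂(P.prod ρ) =
      ∫⁻ x, F x ∂ρ := by
    intro n
    rw [lintegral_prod _ (hFm n).aemeasurable]
    exact lintegral_cfEval_of_stationary h_indep hm h_law hρ n hF
  simp_rw [hconst] at hlim
  have h1 := tendsto_nhds_unique hlim tendsto_const_nhds
  have hFZ : Measurable fun y : Ω × ℂ ↦ (F (Z y.1) : ENNReal) := hF.comp (hZ.comp measurable_fst)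
  rw [lintegral_map hF hZ, ← h1, lintegral_prod _ hFZ.aemeasurable]
  simp

end Random

/-! ### Invariant measures on the projective line -/

lemma measurableEmbedding_coe : MeasurableEmbedding ((↑) : ℂ → OnePoint ℂ) :=
  OnePoint.isOpenEmbedding_coe.measurableEmbedding

lemma matrixA_smul_coe (α t : ℝ) (z : ℂ) :
    matrixA α t • (z : OnePoint ℂ) =
      if z + t * ray α = 0 then OnePoint.infty else ((step α z t : ℂ) : OnePoint ℂ) := by
  rw [OnePoint.smul_some_eq_ite]
  simp only [matrixA, step, ray]
  by_cases h : z + t * Complex.exp (α * Complex.I) = 0 <;> simp [h]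

lemma matrixA_smul_infty (α t : ℝ) :
    matrixA α t • (OnePoint.infty : OnePoint ℂ) = ((0 : ℂ) : OnePoint ℂ) := by
  rw [OnePoint.smul_infty_eq_ite]
  simp [matrixA]

lemma ray_ne_zero (α : ℝ) : ray α ≠ 0 := Complex.exp_ne_zero _

/-- A continuous left inverse makes `t ↦ matrixA α t` a closed embedding, so that integrals against
`mu` pull back to the gamma law without any measurability of the integrand. -/
lemma measurableEmbedding_matrixA (α : ℝ) : MeasurableEmbedding (matrixA α) := by
  have hc : Continuous (matrixA α) := by
    refine Units.continuous_iff.2 ⟨?_, ?_⟩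
    · refine continuous_matrix fun i j ↦ ?_
      fin_cases i <;> fin_cases j <;> simp [matrixA] <;> fun_prop
    · have : ∀ t, ((matrixA α t)⁻¹ : GL (Fin 2) ℂ).val = !![-(t * ray α), 1; 1, 0] := by
        intro t
        rw [Matrix.coe_units_inv]
        refine Matrix.inv_eq_left_inv ?_
        ext i j
        fin_cases i <;> fin_cases j <;> simp [matrixA, ray, Matrix.mul_apply, Fin.sum_univ_two]
      refine continuous_matrix fun i j ↦ ?_
      simp only [this]
      fin_cases i <;> fin_cases j <;> simp <;> fun_prop
  have hl : Function.LeftInverse (fun g : GL (Fin 2) ℂ ↦ ((g.val 1 1) / ray α).re) (matrixA α) := by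
    intro t
    have : (matrixA α t).val 1 1 = t * ray α := by simp [matrixA, ray]
    simp only [this]
    rw [mul_div_cancel_right₀ _ (ray_ne_zero α), Complex.ofReal_re]
  have hcl : Continuous fun g : GL (Fin 2) ℂ ↦ ((g.val 1 1) / ray α).re := by
    have : Continuous fun g : GL (Fin 2) ℂ ↦ g.val 1 1 := Units.continuous_val.matrix_elem 1 1
    fun_prop
  exact (hl.isClosedEmbedding hcl hc).measurableEmbedding

lemma lintegral_mu (α p s : ℝ) (f : GL (Fin 2) ℂ → ENNReal) :
    ∫⁻ g, f g ∂(mu α p s) = ∫⁻ t, f (matrixA α t) ∂(gammaMeasure p (1 / s)) :=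
  (measurableEmbedding_matrixA α).lintegral_map f

/-- A measure has at most countably many atoms, and the gamma law is diffuse. -/
lemma ae_gammaMeasure_measure_singleton_eq_zero {X : Type*} [MeasurableSpace X]
    [MeasurableSingletonClass X] (ρ : Measure X) [SFinite ρ] {g : ℝ → X}
    (hg : Function.Injective g) (p k : ℝ) : ∀ᵐ t ∂(gammaMeasure p k), ρ {g t} = 0 := by
  have hcount : {t | 0 < ρ {g t}}.Countable :=
    Measure.countable_meas_pos_of_disjoint_iUnion (fun t ↦ measurableSet_singleton _)
      fun t t' h ↦ by simpa using fun h' ↦ h (hg h')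
  have h0 : gammaMeasure p k {t | 0 < ρ {g t}} = 0 :=
    withDensity_absolutelyContinuous _ _ (hcount.measure_zero volume)
  filter_upwards [measure_eq_zero_iff_ae_notMem.1 h0] with t ht
  by_contra hc
  exact ht (pos_iff_ne_zero.2 hc)

lemma injective_neg_ray (α : ℝ) : Function.Injective fun t : ℝ ↦ -((t : ℂ) * ray α) :=
  fun _ _ h ↦ Complex.ofReal_injective (mul_right_cancel₀ (ray_ne_zero α) (neg_injective h))

/-- The pole `-t e^{iα}` of the Möbius transformation is a null set for almost every `t`, so that
the invariance on the projective line is stationarity under `step`, in which `0⁻¹ = 0`. -/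
lemma isInvariantMeasure_map_coe_iff {α p s : ℝ} (hp : 0 < p) (hs : 0 < s) (ρ : Measure ℂ)
    [SFinite ρ] :
    IsInvariantMeasure (mu α p s) (ρ.map ((↑) : ℂ → OnePoint ℂ)) ↔
      (ρ.prod (gammaMeasure p (1 / s))).map (fun y ↦ step α y.1 y.2) = ρ := by
  have := isProbabilityMeasure_gammaMeasure hp (one_div_pos.2 hs)
  have he := measurableEmbedding_coe
  have key : ∀ B : Set (OnePoint ℂ), MeasurableSet B →
      ∫⁻ g, (ρ.map ((↑) : ℂ → OnePoint ℂ)) {z | g • z ∈ B} ∂(mu α p s) =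
        ((ρ.prod (gammaMeasure p (1 / s))).map (fun y ↦ step α y.1 y.2))
          (((↑) : ℂ → OnePoint ℂ) ⁻¹' B) := by
    intro B hB
    have hB' : MeasurableSet (((↑) : ℂ → OnePoint ℂ) ⁻¹' B) := he.measurable hB
    rw [lintegral_mu, Measure.map_apply (measurable_step α) hB',
      Measure.prod_apply_symm (measurable_step α hB')]
    refine lintegral_congr_ae ?_
    filter_upwards [ae_gammaMeasure_measure_singleton_eq_zero ρ (injective_neg_ray α) p (1 / s)]
      with t ht
    rw [he.map_apply]
    refine measure_congr ?_
    filter_upwards [measure_eq_zero_iff_ae_notMem.1 ht] with z hz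
    have hz' : z + t * ray α ≠ 0 := fun h ↦ hz (eq_neg_of_add_eq_zero_left h)
    apply propext
    change matrixA α t • (z : OnePoint ℂ) ∈ B ↔ ((step α z t : ℂ) : OnePoint ℂ) ∈ B
    rw [matrixA_smul_coe, if_neg hz']
  constructor
  · intro h
    refine Measure.ext fun B hB ↦ ?_
    have hB' : MeasurableSet (((↑) : ℂ → OnePoint ℂ) '' B) := he.measurableSet_image.2 hB
    have h1 := key _ hB'
    rw [h _ hB', he.map_apply, preimage_image_eq _ he.injective] at h1
    exact h1.symm
  · intro h B hB
    rw [key B hB, h, he.map_apply]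

lemma measure_infty_eq_zero_of_isInvariantMeasure {α p s : ℝ} {ρ : Measure (OnePoint ℂ)}
    [IsFiniteMeasure ρ] (h : IsInvariantMeasure (mu α p s) ρ) : ρ {OnePoint.infty} = 0 := by
  rw [← h _ (measurableSet_singleton _), lintegral_mu]
  have hinj : Function.Injective fun t : ℝ ↦ ((-((t : ℂ) * ray α) : ℂ) : OnePoint ℂ) :=
    (OnePoint.coe_injective).comp (injective_neg_ray α)
  rw [lintegral_congr_ae (g := fun _ ↦ 0), lintegral_zero]
  filter_upwards [ae_gammaMeasure_measure_singleton_eq_zero ρ hinj p (1 / s)] with t ht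
  refine measure_mono_null (fun z hz ↦ ?_) ht
  change matrixA α t • z = OnePoint.infty at hz
  change z = ((-((t : ℂ) * ray α) : ℂ) : OnePoint ℂ)
  induction z using OnePoint.rec with
  | infty => rw [matrixA_smul_infty] at hz; exact absurd hz (OnePoint.coe_ne_infty _)
  | coe z =>
    rw [matrixA_smul_coe] at hz
    by_cases h0 : z + t * ray α = 0
    · rw [eq_neg_of_add_eq_zero_left h0]
    · rw [if_neg h0] at hz; exact absurd hz (OnePoint.coe_ne_infty _)

lemma exists_gt_of_ae_gammaMeasure {p k : ℝ} (hp : 0 < p) (hk : 0 < k) {Q : ℝ → Prop}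
    (h : ∀ᵐ t ∂(gammaMeasure p k), Q t) (M : ℝ) : ∃ t, M < t ∧ 0 < t ∧ Q t := by
  have hg : Measurable (gammaPDF p k) := (measurable_gammaPDFReal _ _).ennreal_ofReal
  rw [gammaMeasure, ae_withDensity_iff hg] at h
  have hne : volume.restrict (Ioi (max M 0)) ≠ 0 := by
    rw [Ne, Measure.restrict_eq_zero, Real.volume_Ioi]; exact ENNReal.top_ne_zero
  have : NeBot (ae (volume.restrict (Ioi (max M 0)))) := ae_neBot.2 hne
  obtain ⟨t, ht, hQ⟩ :=
    ((ae_restrict_mem (μ := volume) (measurableSet_Ioi (a := max M 0))).and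
      (ae_restrict_of_ae h)).exists
  have ht1 : M < t := (le_max_left _ _).trans_lt ht
  have ht0 : 0 < t := (le_max_right _ _).trans_lt ht
  exact ⟨t, ht1, ht0, hQ (ENNReal.ofReal_pos.2 (gammaPDFReal_pos hp hk ht0)).ne'⟩

section Cone

variable {α : ℝ} (hα₀ : 0 < |α|) (hα₁ : |α| < π / 2)

include hα₀ hα₁

lemma cone_measurableSet : MeasurableSet (cone α) := by
  have : cone α = {z | 0 ≤ cu α z} ∩ {z | 0 ≤ cv α z} :=
    Set.ext fun z ↦ mem_cone_iff hα₀ hα₁ z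
  rw [this]
  exact ((isClosed_le continuous_const (continuous_cu α)).inter
    (isClosed_le continuous_const (continuous_cv α))).measurableSet

lemma step_mem_cone_of {x : ℂ} {t : ℝ} (hu : 0 ≤ cu α x + t) (hv : 0 ≤ cv α x) :
    step α x t ∈ cone α := by
  rw [mem_cone_iff hα₀ hα₁, step, cu_inv, cv_inv, cu_add_ray hα₀ hα₁, cv_add_ray]
  exact ⟨div_nonneg hv (Complex.normSq_nonneg _), div_nonneg hu (Complex.normSq_nonneg _)⟩

lemma cv_step_nonneg {x : ℂ} {t : ℝ} (hu : 0 ≤ cu α x + t) : 0 ≤ cv α (step α x t) := by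
  rw [step, cv_inv, cu_add_ray hα₀ hα₁]
  exact div_nonneg hu (Complex.normSq_nonneg _)

/-- The cone is absorbing, and two steps with large `t` lead into it from every point of `ℂ`;
hence a stationary law is carried by the cone. -/
lemma ae_mem_cone_of_stationary {p s : ℝ} (hp : 0 < p) (hs : 0 < s) {ρ : Measure ℂ}
    [IsProbabilityMeasure ρ]
    (hρ : (ρ.prod (gammaMeasure p (1 / s))).map (fun y ↦ step α y.1 y.2) = ρ) :
    ∀ᵐ x ∂ρ, x ∈ cone α := by
  have := isProbabilityMeasure_gammaMeasure hp (one_div_pos.2 hs)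
  set γ := gammaMeasure p (1 / s) with hγ
  have hC := cone_measurableSet hα₀ hα₁
  have hS : (ρ.prod γ) ((fun y ↦ step α y.1 y.2) ⁻¹' cone α) = ρ (cone α) := by
    rw [← Measure.map_apply (measurable_step α) hC, hρ]
  have hT : (ρ.prod γ) (Prod.fst ⁻¹' cone α) = ρ (cone α) := by
    rw [← Measure.map_apply measurable_fst hC, Measure.map_fst_prod, measure_univ, one_smul]
  have hsub : (Prod.fst ⁻¹' cone α : Set (ℂ × ℝ)) ≤ᵐ[ρ.prod γ]
      (fun y ↦ step α y.1 y.2) ⁻¹' cone α := by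
    filter_upwards [Measure.quasiMeasurePreserving_snd.ae (ae_gammaMeasure_pos p (1 / s))]
      with y hy hmem
    have h := (mem_cone_iff hα₀ hα₁ _).1 hmem
    exact step_mem_cone_of hα₀ hα₁ (add_nonneg h.1 hy.le) h.2
  have hae := ae_eq_of_ae_subset_of_measure_ge hsub (by rw [hS, hT])
    (measurable_fst hC).nullMeasurableSet (measure_ne_top _ _)
  have h0 : ∀ᵐ y ∂(ρ.prod γ), step α y.1 y.2 ∈ cone α → y.1 ∈ cone α := by
    filter_upwards [hae] with y hy h
    exact hy.mpr h
  have h1 : ∀ᵐ x ∂ρ, ∀ᵐ t ∂γ, step α x t ∈ cone α → x ∈ cone α :=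
    Measure.ae_ae_of_ae_prod h0
  have h2 : ∀ᵐ y ∂(ρ.prod γ), ∀ᵐ t' ∂γ,
      step α (step α y.1 y.2) t' ∈ cone α → step α y.1 y.2 ∈ cone α := by
    rw [← hρ] at h1
    exact ae_of_ae_map (measurable_step α).aemeasurable h1
  filter_upwards [h1, Measure.ae_ae_of_ae_prod h2] with x hx1 hx2
  obtain ⟨t, ht, -, ht1, ht2⟩ :=
    exists_gt_of_ae_gammaMeasure hp (one_div_pos.2 hs) (hx1.and hx2) (-cu α x)
  obtain ⟨t', ht', -, hmem⟩ :=
    exists_gt_of_ae_gammaMeasure hp (one_div_pos.2 hs) ht2 (-cu α (step α x t))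
  refine ht1 (hmem (step_mem_cone_of hα₀ hα₁ (by linarith) ?_))
  exact cv_step_nonneg hα₀ hα₁ (by linarith)

end Cone

/-! ### The law of the continued fraction and the invariant measures -/

section Law

variable {Ω : Type*} [MeasurableSpace Ω] {P : Measure Ω} [IsProbabilityMeasure P]
  {α p s : ℝ} (hα₀ : 0 < |α|) (hα₁ : |α| < π / 2) (hp : 0 < p) (hs : 0 < s)
  {a : ℕ → Ω → ℝ} (h_indep : iIndepFun a P)
  (h_law : ∀ n, HasLaw (a n) (gammaMeasure p (1 / s)) P)

include hα₀ hα₁ hp hs h_indep h_law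

/-- The continued fraction converges almost surely, and every stationary law is the law of its
value. -/
lemma exists_limit_forall_stationary : ∃ Z : Ω → ℂ, Measurable Z ∧
    (∀ᵐ w ∂P, Tendsto (fun n ↦ (contFrac α fun k ↦ a k w).convs n) atTop (𝓝 (Z w))) ∧
    ∀ ρ : Measure ℂ, IsProbabilityMeasure ρ →
      (ρ.prod (gammaMeasure p (1 / s))).map (fun y ↦ step α y.1 y.2) = ρ → P.map Z = ρ := by
  have := isProbabilityMeasure_gammaMeasure hp (one_div_pos.2 hs)
  -- `HasLaw` gives measurability up to null sets only, so the variables are modified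
  set b : ℕ → Ω → ℝ := fun n ↦ (h_law n).aemeasurable.mk with hb
  have hbm : ∀ n, Measurable (b n) := fun n ↦ (h_law n).aemeasurable.measurable_mk
  have hab : ∀ n, a n =ᵐ[P] b n := fun n ↦ (h_law n).aemeasurable.ae_eq_mk
  have hbi : iIndepFun b P := h_indep.congr hab
  have hbl : ∀ n, P.map (b n) = gammaMeasure p (1 / s) := fun n ↦ by
    rw [← Measure.map_congr (hab n), (h_law n).map_eq]
  have hpos : ∀ᵐ w ∂P, ∀ n, 0 < b n w := ae_all_iff.2 fun n ↦
    ae_of_ae_map (hbm n).aemeasurable (by rw [hbl]; exact ae_gammaMeasure_pos p (1 / s))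
  have hlim : ∀ᵐ w ∂P, ∃ z : ℂ, ∀ x : ℂ, 0 ≤ x.re →
      Tendsto (fun n ↦ cfEval α (fun k ↦ b k w) n x) atTop (𝓝 z) := by
    filter_upwards [hpos, ae_tendsto_sum_min hbi hbm hbl hpos] with w hw hsum
    exact exists_tendsto_cfEval hα₁ hw (tendsto_cfGap hα₁ hw hsum)
  obtain ⟨Y, hY⟩ : ∃ Y : Ω → ℂ, ∀ᵐ w ∂P, ∀ x : ℂ, 0 ≤ x.re →
      Tendsto (fun n ↦ cfEval α (fun k ↦ b k w) n x) atTop (𝓝 (Y w)) := by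
    classical
    refine ⟨fun w ↦ if h : ∃ z : ℂ, ∀ x : ℂ, 0 ≤ x.re →
      Tendsto (fun n ↦ cfEval α (fun k ↦ b k w) n x) atTop (𝓝 z) then h.choose else 0, ?_⟩
    filter_upwards [hlim] with w hw
    rw [dif_pos hw]
    exact hw.choose_spec
  have hmeas : ∀ n, Measurable fun w ↦ cfEval α (fun k ↦ b k w) n 0 := fun n ↦
    (measurable_cfEval α n).comp ((measurable_pi_lambda _ hbm).prodMk measurable_const)
  have hYm : AEMeasurable Y P := aemeasurable_of_tendsto_metrizable_ae atTop
    (fun n ↦ (hmeas n).aemeasurable) (hY.mono fun w hw ↦ hw 0 le_rfl)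
  have hZ : ∀ᵐ w ∂P, ∀ x : ℂ, 0 ≤ x.re →
      Tendsto (fun n ↦ cfEval α (fun k ↦ b k w) n x) atTop (𝓝 (hYm.mk Y w)) := by
    filter_upwards [hY, hYm.ae_eq_mk] with w h1 h2
    rwa [← h2]
  refine ⟨hYm.mk Y, hYm.measurable_mk, ?_, fun ρ hρ hstat ↦ ?_⟩
  · filter_upwards [hZ, hpos, ae_all_iff.2 hab] with w h1 h2 h3
    have h4 : (fun k ↦ a k w) = fun k ↦ b k w := funext h3
    simp_rw [h4, convs_eq_cfEval hα₁ h2]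
    exact h1 0 le_rfl
  · have hcone := ae_mem_cone_of_stationary hα₀ hα₁ hp hs hstat
    exact map_eq_of_stationary hbi hbm hbl hstat
      (hcone.mono fun x hx ↦ re_nonneg_of_mem_cone hα₀ hα₁ hx) hYm.measurable_mk hZ

end Law

/-- An invariant probability measure has no mass at infinity, hence comes from a stationary law on
`ℂ`. -/
lemma exists_stationary_of_isInvariantMeasure {α p s : ℝ} (hp : 0 < p) (hs : 0 < s)
    {ρ : Measure (OnePoint ℂ)} [IsProbabilityMeasure ρ]
    (h : IsInvariantMeasure (mu α p s) ρ) :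
    ∃ ρ' : Measure ℂ, IsProbabilityMeasure ρ' ∧ ρ'.map ((↑) : ℂ → OnePoint ℂ) = ρ ∧
      (ρ'.prod (gammaMeasure p (1 / s))).map (fun y ↦ step α y.1 y.2) = ρ' := by
  have he := measurableEmbedding_coe
  have hmap : (ρ.comap ((↑) : ℂ → OnePoint ℂ)).map ((↑) : ℂ → OnePoint ℂ) = ρ := by
    rw [he.map_comap, Measure.restrict_eq_self_of_ae_mem]
    filter_upwards [measure_eq_zero_iff_ae_notMem.1
      (measure_infty_eq_zero_of_isInvariantMeasure h)] with z hz
    induction z using OnePoint.rec with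
    | infty => exact absurd rfl hz
    | coe z => exact mem_range_self z
  have hprob : IsProbabilityMeasure (ρ.comap ((↑) : ℂ → OnePoint ℂ)) := by
    refine ⟨?_⟩
    have h1 := Measure.map_apply (μ := ρ.comap ((↑) : ℂ → OnePoint ℂ)) he.measurable
      MeasurableSet.univ
    rw [hmap, measure_univ, preimage_univ] at h1
    exact h1.symm
  refine ⟨_, hprob, hmap, ?_⟩
  rw [← isInvariantMeasure_map_coe_iff hp hs, hmap]
  exact h

end RandomCF

theorem mainTheorem1 {Ω : Type*} [MeasurableSpace Ω] (P : Measure Ω) [IsProbabilityMeasure P]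
    (α p s : ℝ) (hα₀ : 0 < |α|) (hα₁ : |α| < π / 2) (hp : 0 < p) (hs : 0 < s)
    (a : ℕ → Ω → ℝ) (h_indep : iIndepFun a P)
    (h_law : ∀ n, HasLaw (a n) (gammaMeasure p (1 / s)) P) :
    -- the random continued fraction converges almost surely, and its value has density `f_α`
    (∃ Z : Ω → ℂ, Measurable Z ∧
      (∀ᵐ w ∂P, Tendsto (fun n ↦ (RandomCF.contFrac α fun k ↦ a k w).convs n) atTop (𝓝 (Z w))) ∧
      (∀ᵐ w ∂P, Z w ∈ RandomCF.cone α) ∧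
      HasLaw Z (RandomCF.nu α p s) P) ∧
    -- the same measure is the unique invariant probability measure on the projective line
    RandomCF.IsInvariantMeasure (RandomCF.mu α p s)
      ((RandomCF.nu α p s).map ((↑) : ℂ → OnePoint ℂ)) ∧
    (∀ ρ : Measure (OnePoint ℂ), IsProbabilityMeasure ρ →
      RandomCF.IsInvariantMeasure (RandomCF.mu α p s) ρ →
        ρ = (RandomCF.nu α p s).map ((↑) : ℂ → OnePoint ℂ)) ∧
    -- the support, the smoothness and the exponential decay of the density
    tsupport (RandomCF.density α p s) = RandomCF.cone α ∧
    ContDiff ℝ ∞ (RandomCF.density α p s) ∧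
    (∀ θ : ℝ, |θ| ≤ |α| → ∃ c : ℝ, 0 < c ∧
      (fun r : ℝ ↦ RandomCF.density α p s (r * Complex.exp (θ * Complex.I)))
        =O[atTop] fun r : ℝ ↦ Real.exp (-c * r)) := by
  have hnu := RandomCF.isProbabilityMeasure_nu (p := p) hα₀ hα₁ hs
  have hstat := RandomCF.map_step_nu hα₀ hα₁ hp hs
  obtain ⟨Z, hZm, hZ, hlaw⟩ :=
    RandomCF.exists_limit_forall_stationary hα₀ hα₁ hp hs h_indep h_law
  have hZnu : P.map Z = RandomCF.nu α p s := hlaw _ hnu hstat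
  refine ⟨⟨Z, hZm, hZ, ?_, hZm.aemeasurable, hZnu⟩,
    (RandomCF.isInvariantMeasure_map_coe_iff hp hs _).2 hstat, fun ρ hρ hinv ↦ ?_,
    RandomCF.tsupport_density hα₀ hα₁ (RandomCF.besselNorm_pos hα₀ hα₁ hs),
    RandomCF.contDiff_density hα₀ hα₁ hs,
    fun θ _ ↦ RandomCF.density_isBigO_exp hα₀ hα₁ hs θ⟩
  · refine ae_of_ae_map hZm.aemeasurable ?_
    rw [hZnu]
    exact RandomCF.ae_mem_cone_of_stationary hα₀ hα₁ hp hs hstat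
  · obtain ⟨ρ', hρ', hmap, hstat'⟩ :=
      RandomCF.exists_stationary_of_isInvariantMeasure hp hs hinv
    rw [← hmap, ← hlaw ρ' hρ' hstat', hZnu]
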